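/- Graphs are finite and may have loops and parallel edges. A plane graph is a graph $G$ together with an embedding in the plane; its planar dual $G^*$ has the faces as vertices and the same edge set $E(G^*)=E(G)$, each edge joining the faces on its two sides. A \emph{5-configuration} of $G$ is a set of exactly five edges of $G$. \emph{Dodgson polynomials and splitting.} Give each edge $e$ a variable $x_e$, orient $G$ arbitrarily, let $A=\mathrm{diag}(x_e)_{e\in E(G)}$, let $\hat\xi$ be the signed $E(G)\times V(G)$ incidence matrix with one arbitrary column deleted, and put $M_G=\begin{pmatrix}A&\hat\xi\\-\hat\xi^{T}&0\end{pmatrix}$. For $I,J,K\subseteq E(G)$ with $|I|=|J|$, the Dodgson polynomial $\Psi^{I,J}_K$ (well defined up to sign) is the determinant of the matrix obtained from $M_G$ by deleting the rows in $I$ and the columns in $J$ and setting $x_e=0$ for $e\in K$. A 5-configuration $S$ \emph{splits} in $G$ if $\Psi^{I,J}_K=0$ identically for some $I,J,K$ with $I\cup J\cup K=S$, $I\cap K=J\cap K=\emptyset$ and either $|I|=|J|=2$, $|K|=1$, $I\cap J=\emptyset$, or $|I|=|J|=3$, $K=\emptyset$, $|I\cap J|=1$. The graph $G$ \emph{splits}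 if every 5-configuration of $G$ splits in $G$. \emph{Enhanced graphs.} An enhanced graph is a graph $G$ with two sets $C,D\subseteq E(G)$, of \emph{contract-proof} and \emph{delete-proof} edges. A separation of a graph is a pair $(A,B)$ of disjoint edge sets whose union is the whole edge set; its order is the number of vertices incident both with an edge of $A$ and with an edge of $B$. A 5-configuration $S$ \emph{splits} in the enhanced graph $(G,C,D)$ if one of the graphs $G$, $G\setminus e$ with $e\in S\setminus D$, or $G/e$ with $e\in S\setminus C$, has a separation $(A,B)$ such that either its order is at most $1$ and $A\cap S\ne\emptyset\ne B\cap S$, or its order is $2$ and $\min\{|A\cap S|,|B\cap S|\}=2$. (Contracting a loop means deleting it.) The dual of an enhanced plane graph $(G,C,D)$ is $(G^*,D,C)$, that is, contract-proof and delete-proof edges are exchanged. \textbf{Proposition.} (1) Let $G$ be a connected plane graph. Then $G$ splits if and only if $G^*$ splits. (2) Let $(G,C,D)$ be an enhanced plane graph, connected or not, and let $S$ be a 5-configuration of $G$. Then $S$ splits in $(G,C,D)$ if and only if $S$ splits in the dual $(G^*,D,C)$. -/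

import Mathlib

open scoped Graph

namespace FeynmanSplit

/-! ### Multigraphs: connectedness and contraction -/

section Basic

/-- `G` is connected: it has a vertex, and any two vertices are joined by a walk. -/
def Connected {α β : Type*} (G : Graph α β) : Prop :=
  V(G).Nonempty ∧ ∀ x ∈ V(G), ∀ y ∈ V(G), Relation.ReflTransGen G.Adj x y

/-- The connected components of `G`: the quotient of the vertex set by the equivalence relation
generated by adjacency. Isolated vertices are components. -/
def Component {α β : Type*} (G : Graph α β) : Type _ :=
  Quot (fun x y : V(G) => G.Adj x y)

/-- The contraction `G / e`: the edge `e` is removed and its ends are identified. The edge set of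
the result is `E(G) \ {e}`. Contracting a loop amounts to deleting it. -/
def contractEdge {α β : Type*} (G : Graph α β) (e : β) : Graph (Quot (G.IsLink e)) β :=
  (G.deleteEdges {e}).map (Quot.mk (G.IsLink e))

end Basic

/-! ### Kirchhoff matrix, Dodgson polynomials, and Feynman 5-splitting -/

section Dodgson

/-- An orientation of the edges of `G`. -/
structure Orientation {α β : Type*} (G : Graph α β) where
  tail : E(G) → α
  head : E(G) → α
  isLink : ∀ e : E(G), G.IsLink e (tail e) (head e)

/-- The vertices of `G` other than the vertex `r`, whose column is deleted. -/
abbrev VertexNe {α β : Type*} (G : Graph α β) (r : V(G)) : Type _ := {v : V(G) // v ≠ r}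

open Classical in
/-- The signed incidence matrix, without the column of `r`. The row of a loop is zero. -/
noncomputable def incidence {α β : Type*} {G : Graph α β} (o : Orientation G) (r : V(G)) :
    Matrix E(G) (VertexNe G r) (MvPolynomial β ℤ) :=
  Matrix.of fun e v =>
    (if o.head e = v.1.1 then 1 else 0) - (if o.tail e = v.1.1 then 1 else 0)

open Classical in
/-- The matrix `M_G = [A, ξ; -ξᵀ, 0]`, where `A` is the diagonal matrix of the edge variables
`x_e` and `ξ` is the incidence matrix with one column deleted. -/
noncomputable def kirchhoffMatrix {α β : Type*} {G : Graph α β} (o : Orientation G) (r : V(G)) :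
    Matrix (E(G) ⊕ VertexNe G r) (E(G) ⊕ VertexNe G r) (MvPolynomial β ℤ) :=
  Matrix.fromBlocks (Matrix.diagonal fun e : E(G) => MvPolynomial.X e.1) (incidence o r)
    (-(incidence o r).transpose) 0

open Classical in
/-- The substitution `x_e = 0` for all `e ∈ K`. -/
noncomputable def setZero {β : Type*} (K : Set β) : MvPolynomial β ℤ →ₐ[ℤ] MvPolynomial β ℤ :=
  MvPolynomial.aeval fun e => if e ∈ K then 0 else MvPolynomial.X e

/-- The row (or column) indices of `M_G` that remain when the edges in `I` are removed. -/
abbrev Remaining {α β : Type*} (G : Graph α β) (r : V(G)) (I : Set β) : Type _ :=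
  {e : E(G) // e.1 ∉ I} ⊕ VertexNe G r

/-- The Dodgson polynomial `Ψ^{I,J}_K = det M_G(I,J)_K`: the rows in `I` and the columns in `J` are
removed and `x_e = 0` for `e ∈ K`. The determinant depends on an orientation `o`, a vertex `r` and
orderings `ρ`, `κ` of the remaining rows and columns, but only up to sign. -/
noncomputable def dodgson {α β : Type*} {G : Graph α β} (o : Orientation G) (r : V(G))
    (I J K : Set β) {n : ℕ} (ρ : Fin n ≃ Remaining G r I) (κ : Fin n ≃ Remaining G r J) :
    MvPolynomial β ℤ :=
  (((kirchhoffMatrix o r).map (setZero K)).submatrix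
    (fun i => Sum.map (fun e : {e : E(G) // e.1 ∉ I} => e.1) id (ρ i))
    (fun j => Sum.map (fun e : {e : E(G) // e.1 ∉ J} => e.1) id (κ j))).det

/-- `S` is a 5-configuration in `G`: a set of exactly five edges. -/
def IsFiveConfig {α β : Type*} (G : Graph α β) (S : Set β) : Prop :=
  S ⊆ E(G) ∧ S.ncard = 5

/-- The index triples `(I, J, K)` of the thirty Dodgson polynomials associated with `S`
(the triples `(I, J, K)` and `(J, I, K)` give the same polynomial up to sign). -/
def IsDodgsonIndex {β : Type*} (S I J K : Set β) : Prop :=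
  I ∪ J ∪ K = S ∧ I ∩ K = ∅ ∧ J ∩ K = ∅ ∧
    ((I.ncard = 2 ∧ J.ncard = 2 ∧ K.ncard = 1 ∧ I ∩ J = ∅) ∨
      (I.ncard = 3 ∧ J.ncard = 3 ∧ K = ∅ ∧ (I ∩ J).ncard = 1))

/-- The 5-configuration `S` splits in `G`: at least one of the thirty Dodgson polynomials
associated with `S` is identically zero. -/
def ConfigSplits {α β : Type*} (G : Graph α β) (S : Set β) : Prop :=
  ∃ I J K : Set β, IsDodgsonIndex S I J K ∧
    ∃ (o : Orientation G) (r : V(G)) (n : ℕ) (ρ : Fin n ≃ Remaining G r I)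
      (κ : Fin n ≃ Remaining G r J), dodgson o r I J K ρ κ = 0

/-- `G` splits (is Feynman 5-split): every 5-configuration of `G` splits. -/
def Splits {α β : Type*} (G : Graph α β) : Prop :=
  ∀ S : Set β, IsFiveConfig G S → ConfigSplits G S

end Dodgson

/-! ### Plane embeddings and planar duals -/

section Plane

/-- Every edge `e` is made of the two opposite darts `(e, false)` and `(e, true)`. -/
abbrev Dart {α β : Type*} (G : Graph α β) : Type _ := E(G) × Bool

/-- The dart opposite to `d`. -/
def Dart.rev {α β : Type*} {G : Graph α β} (d : Dart G) : Dart G := (d.1, !d.2)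

/-- A drawing of `G` on an oriented surface, given combinatorially by a rotation system, together
with a set `φ` of faces and the assignment to each dart of the face on its left. -/
structure Drawing {α β : Type*} (G : Graph α β) (φ : Type*) where
  /-- The vertex from which a dart emanates. -/
  tail : Dart G → α
  isLink_tail : ∀ e : E(G), G.IsLink e (tail (e, false)) (tail (e, true))
  /-- The next dart in counterclockwise order around the vertex from which a dart emanates. -/
  rot : Equiv.Perm (Dart G)
  /-- The darts emanating from a given vertex form a single cycle of `rot`. -/
  sameCycle_rot : ∀ d d' : Dart G, rot.SameCycle d d' ↔ tail d = tail d'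
  /-- The face to the left of a dart. -/
  face : Dart G → φ
  /-- If a face boundary is followed along `d`, with the face on the left, then it continues with
  the dart `rot⁻¹ (rev d)`; so both have the same face on their left. Several closed boundary
  walks, from different components of `G`, may belong to the same face. -/
  face_next : ∀ d : Dart G, face (rot.symm (Dart.rev d)) = face d

/-- The dual of a drawn graph, on the same edge set: its vertices are the faces, and each edge joins
the faces on its two sides. -/
def Drawing.dual {α β φ : Type*} {G : Graph α β} (P : Drawing G φ) : Graph φ β where
  vertexSet := Set.univ
  IsLink e f g := ∃ d : Dart G, d.1.1 = e ∧ P.face d = f ∧ P.face (Dart.rev d) = g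
  edgeSet := E(G)
  isLink_symm := by
    rintro e -
    refine ⟨?_⟩
    rintro f g ⟨d, hd, hf, hg⟩
    exact ⟨Dart.rev d, hd, hg, by simpa [Dart.rev] using hf⟩
  eq_or_eq_of_isLink_of_isLink := by
    rintro e f g f' g' ⟨⟨a, b⟩, ha, hf, hg⟩ ⟨⟨a', b'⟩, ha', hf', hg'⟩
    obtain rfl : a = a' := Subtype.ext (ha.trans ha'.symm)
    cases b <;> cases b' <;> simp_all [Dart.rev]
  edge_mem_iff_exists_isLink := by
    intro e
    constructor
    · intro he
      exact ⟨_, _, (⟨e, he⟩, false), rfl, rfl, rfl⟩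
    · rintro ⟨f, g, d, rfl, -⟩
      exact d.1.2
  left_mem_of_isLink := fun _ _ _ _ => Set.mem_univ _

/-- An embedding of the finite graph `G` in the plane (equivalently, in the sphere), with set of
faces `φ`: a drawing whose dual is connected and which satisfies Euler's formula
`|V| - |E| + |F| = 1 + c`, where `c` is the number of components of `G`.

For connected `G` this is the usual notion of a rotation system of genus `0`, the faces being the
cycles of the face permutation `d ↦ rot⁻¹ (rev d)`. For general `G` it says that every component is
embedded with genus `0` and that the incidence structure of the components and the faces is a
tree. The faces that contain isolated vertices are not recorded, since the dual does not depend
on them. -/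
structure PlaneEmbedding {α β : Type*} (G : Graph α β) (φ : Type*) extends Drawing G φ where
  finite_faces : Finite φ
  dual_connected : Connected toDrawing.dual
  euler : Nat.card V(G) + Nat.card φ = Nat.card E(G) + 1 + Nat.card (Component G)

/-- The planar dual `G*` of the plane graph `G`. -/
abbrev PlaneEmbedding.dual {α β φ : Type*} {G : Graph α β} (P : PlaneEmbedding G φ) : Graph φ β :=
  P.toDrawing.dual

end Plane

/-! ### Separations and enhanced graphs -/

section Enhanced

/-- `(A, B)` is a separation of `G`: a partition of the edge set into two (possibly empty) parts. -/
def IsSeparation {α β : Type*} (G : Graph α β) (A B : Set β) : Prop :=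
  A ∩ B = ∅ ∧ A ∪ B = E(G)

/-- The vertex set of the subgraph of `G` induced by the edge set `A`. -/
def edgeVerts {α β : Type*} (G : Graph α β) (A : Set β) : Set α :=
  {v | ∃ e ∈ A, G.Inc e v}

/-- The order of a separation: the number of vertices that its two sides share. -/
noncomputable def sepOrder {α β : Type*} (G : Graph α β) (A B : Set β) : ℕ :=
  (edgeVerts G A ∩ edgeVerts G B).ncard

/-- `G` has a separation of order at most `1` with edges of `S` on both sides, or a separation of
order `2` with exactly two edges of `S` on one side and at least two on the other. -/
def HasSplittingSeparation {α β : Type*} (G : Graph α β) (S : Set β) : Prop :=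
  ∃ A B : Set β, IsSeparation G A B ∧
    ((sepOrder G A B ≤ 1 ∧ (A ∩ S).Nonempty ∧ (B ∩ S).Nonempty) ∨
      (sepOrder G A B = 2 ∧ min (A ∩ S).ncard (B ∩ S).ncard = 2))

/-- An enhanced graph: a graph with a set of contract-proof and a set of delete-proof edges. -/
structure EnhancedGraph (α β : Type*) where
  graph : Graph α β
  contractProof : Set β
  deleteProof : Set β
  contractProof_subset : contractProof ⊆ E(graph)
  deleteProof_subset : deleteProof ⊆ E(graph)

/-- The 5-configuration `S` splits in the enhanced graph `H`: a splitting separation exists in the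
graph itself, or after the deletion of an edge of `S` that is not delete-proof, or after the
contraction of an edge of `S` that is not contract-proof. -/
def EnhancedGraph.ConfigSplits {α β : Type*} (H : EnhancedGraph α β) (S : Set β) : Prop :=
  HasSplittingSeparation H.graph S ∨
    (∃ e ∈ S \ H.deleteProof, HasSplittingSeparation (H.graph.deleteEdges {e}) S) ∨
    (∃ e ∈ S \ H.contractProof, HasSplittingSeparation (contractEdge H.graph e) S)

/-- The dual of an enhanced plane graph: the planar dual of the underlying graph, with the
contract-proof and the delete-proof edges exchanged. -/
def EnhancedGraph.dual {α β φ : Type*} (H : EnhancedGraph α β) (P : PlaneEmbedding H.graph φ) :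
    EnhancedGraph φ β where
  graph := P.dual
  contractProof := H.deleteProof
  deleteProof := H.contractProof
  contractProof_subset := H.deleteProof_subset
  deleteProof_subset := H.contractProof_subset

end Enhanced

end FeynmanSplit

/-! Both parts rest on one linear statement. Orient `G` and `G*` compatibly. Then the spaces of
potential differences of `G` and of `G*` are orthogonal complements in `ℝ^E`, so the flows of either
graph are exactly the potential differences of the other (`DualPair`, obtained in
`PlaneEmbedding.dualPair`). Orthogonality is a rearrangement of a sum over darts and needs only the
rotation system (`Drawing.sum_mul_eq_zero`). That nothing is missing is a dimension count: the ranks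
are at least `|V| - c` and `|F| - 1`, and Euler's formula makes these add up to `|E|`. `DualPair` is
symmetric, so the double dual is never needed.

Enhanced graphs. For an edge set `A`, consider the pairing over `A` between potential differences
and flows. It vanishes if `(A, E \ A)` has order at most 1 and has rank at most 1 if the order is 2.
Both rank conditions are invariant under exchanging potential differences and flows, hence
self-dual. The converse fails for a fixed `A`, because the two sides may be disconnected. However,
whenever a separation satisfies the rank condition and distributes `S` suitably, some other
separation has small order and still splits `S` (`exists_bdry_card_le_one`, `RankOneSep.combSplit`);
for rank one this uses `|S| = 5`. So splitting by a separation is self-dual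
(`combSplit_iff_linearSplit`, `DualPair.linearSplit_iff`), and since deletion is dual to contraction
(`DualPair.delete_contract`), so is splitting in an enhanced graph.

Dodgson polynomials. Each edge variable occurs in at most one row of the matrix, so the determinant
is nonzero if and only if it stays nonzero when every row is replaced by its constant part or by its
leading coefficient, for a suitable choice. For connected `G` such a choice amounts to a set `X ⊇ S`
such that `X \ I` is spanning and `X \ J` is a forest (`dodgson_ne_zero_iff_contributes`). In a dual
pair, complements of spanning sets are forests and conversely. So replacing `X` by `Xᶜ ∪ S` turns
the condition for `(I, J, K)` in `G` into that for `(S \ J, S \ I, I ∩ J)` in `G*`, and this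
operation exchanges the two types of index triples when `|S| = 5` (`DualPair.contributes`,
`IsDodgsonIndex.compl`). -/

namespace FeynmanSplit

/-! ### Potential differences, flows and dual pairs. -/

section Flows

variable {α β φ : Type*}

/-- The maps `t` and `h` choose a tail and a head for every edge of `G`. -/
def Orients (G : Graph α β) (t h : β → α) : Prop :=
  ∀ e ∈ E(G), G.IsLink e (t e) (h e)

/-- `z` is a flow (a real cycle) of the oriented graph with edges `E`, tails `t` and heads `h`: it
is orthogonal to all potential differences. -/
def IsFlow (E : Finset β) (t h : β → α) (z : β → ℝ) : Prop :=
  ∀ f : α → ℝ, ∑ e ∈ E, z e * (f (h e) - f (t e)) = 0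

/-- Two oriented graphs on the same edge set whose spaces of potential differences are orthogonal
complements of each other. -/
structure DualPair (E : Finset β) (t h : β → α) (t' h' : β → φ) : Prop where
  orthogonal : ∀ (f : α → ℝ) (g : φ → ℝ),
    ∑ e ∈ E, (f (h e) - f (t e)) * (g (h' e) - g (t' e)) = 0
  exists_right : ∀ z, IsFlow E t h z → ∃ g : φ → ℝ, ∀ e ∈ E, z e = g (h' e) - g (t' e)
  exists_left : ∀ z, IsFlow E t' h' z → ∃ f : α → ℝ, ∀ e ∈ E, z e = f (h e) - f (t e)

theorem DualPair.symm {E : Finset β} {t h : β → α} {t' h' : β → φ} (D : DualPair E t h t' h') :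
    DualPair E t' h' t h where
  orthogonal f g := by simpa only [mul_comm] using D.orthogonal g f
  exists_right := D.exists_left
  exists_left := D.exists_right

theorem DualPair.isFlow_left {E : Finset β} {t h : β → α} {t' h' : β → φ}
    (D : DualPair E t h t' h') (g : φ → ℝ) : IsFlow E t h fun e => g (h' e) - g (t' e) :=
  fun f => by simpa only [mul_comm] using D.orthogonal f g

open Classical in
/-- Deletion and contraction are dual to each other. -/
theorem DualPair.delete_contract {E : Finset β} {t h : β → α} {t' h' : β → φ}
    (D : DualPair E t h t' h') {e : β} (he : e ∈ E) {r : φ → φ → Prop}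
    (hr : ∀ x y, r x y ↔ (x = t' e ∧ y = h' e) ∨ (x = h' e ∧ y = t' e)) :
    DualPair (E.erase e) t h (fun a => Quot.mk r (t' a)) (fun a => Quot.mk r (h' a)) := by
  have hq : Quot.mk r (t' e) = Quot.mk r (h' e) := Quot.sound ((hr _ _).2 (Or.inl ⟨rfl, rfl⟩))
  refine ⟨fun f g => ?_, fun z hz => ?_, fun z hz => ?_⟩
  · have := D.orthogonal f (fun x => g (Quot.mk r x))
    rw [← Finset.add_sum_erase E _ he] at this
    simpa [hq] using this
  -- A flow avoiding `e` extends by zero. The dual potential then agrees at the two ends of `e`, so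
  -- it descends to the contraction.
  · have hz' : IsFlow E t h (Function.update z e 0) := fun f => by
      refine Eq.trans ?_ (hz f)
      rw [← Finset.add_sum_erase E _ he]
      simp only [Function.update_self, zero_mul, zero_add]
      exact Finset.sum_congr rfl fun a ha => by
        rw [Function.update_of_ne (Finset.ne_of_mem_erase ha)]
    obtain ⟨g, hg⟩ := D.exists_right _ hz'
    have hge : g (h' e) = g (t' e) := by
      have := hg e he
      simp only [Function.update_self] at this
      linarith
    refine ⟨Quot.lift g fun x y hxy => ?_, fun a ha => ?_⟩
    · rcases (hr x y).1 hxy with ⟨rfl, rfl⟩ | ⟨rfl, rfl⟩ <;> simp [hge]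
    · rw [← hg a (Finset.mem_of_mem_erase ha),
        Function.update_of_ne (Finset.ne_of_mem_erase ha)]
  · have key : ∀ g : φ → ℝ, g (h' e) = g (t' e) →
        ∑ a ∈ E.erase e, z a * (g (h' a) - g (t' a)) = 0 := fun g hge =>
      hz (Quot.lift g fun x y hxy => by
        rcases (hr x y).1 hxy with ⟨rfl, rfl⟩ | ⟨rfl, rfl⟩ <;> simp [hge])
    -- A flow of the contraction lifts to a flow once the right value on `e` is chosen.
    suffices H : ∃ c, IsFlow E t' h' (Function.update z e c) by
      obtain ⟨c, hc⟩ := H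
      obtain ⟨f, hf⟩ := D.exists_left _ hc
      exact ⟨f, fun a ha => by
        rw [← hf a (Finset.mem_of_mem_erase ha),
          Function.update_of_ne (Finset.ne_of_mem_erase ha)]⟩
    have split : ∀ (c : ℝ) (g : φ → ℝ),
        ∑ a ∈ E, Function.update z e c a * (g (h' a) - g (t' a)) =
          c * (g (h' e) - g (t' e)) + ∑ a ∈ E.erase e, z a * (g (h' a) - g (t' a)) := by
      intro c g
      rw [← Finset.add_sum_erase E _ he, Function.update_self]
      congr 1
      exact Finset.sum_congr rfl fun a ha => by
        rw [Function.update_of_ne (Finset.ne_of_mem_erase ha)]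
    by_cases hl : h' e = t' e
    · exact ⟨0, fun g => by rw [split, key g (by rw [hl])]; simp⟩
    -- Testing against the indicator of one end of `e` dictates the value. Any potential differs by
    -- a multiple of `g₀` from one that is equal at the ends of `e`, where `key` applies.
    · set g₀ : φ → ℝ := fun x => if x = h' e then 1 else 0 with hg₀
      refine ⟨-∑ a ∈ E.erase e, z a * (g₀ (h' a) - g₀ (t' a)), fun g => ?_⟩
      have h1 := key (fun x => g x - (g (h' e) - g (t' e)) * g₀ x) (by
        simp [hg₀, Ne.symm hl])
      have h2 : ∑ a ∈ E.erase e, z a * (g (h' a) - g (t' a)) =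
          (g (h' e) - g (t' e)) * ∑ a ∈ E.erase e, z a * (g₀ (h' a) - g₀ (t' a)) := by
        rw [← sub_eq_zero, ← h1, Finset.mul_sum, ← Finset.sum_sub_distrib]
        exact Finset.sum_congr rfl fun a _ => by ring
      rw [split, h2]
      ring

theorem Orients.isLink_iff {G : Graph α β} {t h : β → α} (o : Orients G t h) {e : β}
    (he : e ∈ E(G)) (x y : α) :
    G.IsLink e x y ↔ (x = t e ∧ y = h e) ∨ (x = h e ∧ y = t e) := by
  rw [(o e he).isLink_iff]
  grind

theorem Orients.deleteEdges {G : Graph α β} {t h : β → α} (o : Orients G t h) (F : Set β) :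
    Orients (G.deleteEdges F) t h := fun e he => by
  simp only [Graph.edgeSet_deleteEdges, Set.mem_sdiff] at he
  simp [Graph.deleteEdges_isLink, o e he.1, he.2]

theorem Orients.contractEdge {G : Graph α β} {t h : β → α} (o : Orients G t h) (e : β) :
    Orients (contractEdge G e) (fun a => Quot.mk _ (t a)) (fun a => Quot.mk _ (h a)) :=
  fun a ha => by
    have ha' : a ∈ E(G.deleteEdges {e}) := by simpa [FeynmanSplit.contractEdge] using ha
    have := o.deleteEdges {e} a ha'
    simp only [FeynmanSplit.contractEdge, Graph.map_isLink]
    exact ⟨_, _, this, rfl, rfl⟩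

end Flows

/-! ### Rank conditions and orders of separations. -/

section Separations

open Classical

variable {α β φ : Type*}

/-- The part `A` of the edge set carries no exchange between potential differences and flows. -/
def NullSep (E : Finset β) (t h : β → α) (A : Finset β) : Prop :=
  ∀ (f : α → ℝ) (z : β → ℝ), IsFlow E t h z → ∑ e ∈ A, z e * (f (h e) - f (t e)) = 0

/-- The pairing over `A` between potential differences and flows has rank at most one. -/
def RankOneSep (E : Finset β) (t h : β → α) (A : Finset β) : Prop :=
  ∀ (f₁ f₂ : α → ℝ) (z₁ z₂ : β → ℝ), IsFlow E t h z₁ → IsFlow E t h z₂ →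
    (∑ e ∈ A, z₁ e * (f₁ (h e) - f₁ (t e))) * (∑ e ∈ A, z₂ e * (f₂ (h e) - f₂ (t e))) =
    (∑ e ∈ A, z₂ e * (f₁ (h e) - f₁ (t e))) * (∑ e ∈ A, z₁ e * (f₂ (h e) - f₂ (t e)))

/-- A self-dual version of the existence of a splitting separation. -/
def LinearSplit (E : Finset β) (t h : β → α) (S : Finset β) : Prop :=
  ∃ A ⊆ E, (NullSep E t h A ∧ (A ∩ S).Nonempty ∧ ((E \ A) ∩ S).Nonempty) ∨
    (RankOneSep E t h A ∧ 2 ≤ (A ∩ S).card ∧ 2 ≤ ((E \ A) ∩ S).card)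

/-- The vertices shared by `A` and `E \ A`. -/
noncomputable def bdry (E : Finset β) (t h : β → α) (A : Finset β) : Finset α :=
  (A.image t ∪ A.image h) ∩ ((E \ A).image t ∪ (E \ A).image h)

/-- The existence of a splitting separation, in terms of finite sets. -/
def CombSplit (E : Finset β) (t h : β → α) (S : Finset β) : Prop :=
  ∃ A ⊆ E, ((bdry E t h A).card ≤ 1 ∧ (A ∩ S).Nonempty ∧ ((E \ A) ∩ S).Nonempty) ∨
    ((bdry E t h A).card = 2 ∧ min (A ∩ S).card ((E \ A) ∩ S).card = 2)

theorem DualPair.nullSep {E : Finset β} {t h : β → α} {t' h' : β → φ}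
    (D : DualPair E t h t' h') {A : Finset β} (hA : A ⊆ E) (H : NullSep E t h A) :
    NullSep E t' h' A := fun g z hz => by
  obtain ⟨f, hf⟩ := D.exists_left z hz
  rw [← H f _ (D.isFlow_left g)]
  exact Finset.sum_congr rfl fun e he => by rw [hf e (hA he), mul_comm]

theorem DualPair.rankOneSep {E : Finset β} {t h : β → α} {t' h' : β → φ}
    (D : DualPair E t h t' h') {A : Finset β} (hA : A ⊆ E) (H : RankOneSep E t h A) :
    RankOneSep E t' h' A := fun g₁ g₂ z₁ z₂ hz₁ hz₂ => by
  obtain ⟨f₁, hf₁⟩ := D.exists_left z₁ hz₁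
  obtain ⟨f₂, hf₂⟩ := D.exists_left z₂ hz₂
  have key : ∀ (g : φ → ℝ) (z : β → ℝ) (f : α → ℝ), (∀ e ∈ E, z e = f (h e) - f (t e)) →
      ∑ e ∈ A, z e * (g (h' e) - g (t' e)) =
        ∑ e ∈ A, (g (h' e) - g (t' e)) * (f (h e) - f (t e)) := fun g z f hf =>
    Finset.sum_congr rfl fun e he => by rw [hf e (hA he), mul_comm]
  rw [key g₁ z₁ f₁ hf₁, key g₂ z₂ f₂ hf₂, key g₁ z₂ f₂ hf₂, key g₂ z₁ f₁ hf₁,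
    H f₁ f₂ _ _ (D.isFlow_left g₁) (D.isFlow_left g₂)]
  ring

theorem DualPair.linearSplit_iff {E : Finset β} {t h : β → α} {t' h' : β → φ}
    (D : DualPair E t h t' h') (S : Finset β) :
    LinearSplit E t h S ↔ LinearSplit E t' h' S := by
  constructor
  · rintro ⟨A, hA, ⟨H, H'⟩ | ⟨H, H'⟩⟩
    exacts [⟨A, hA, Or.inl ⟨D.nullSep hA H, H'⟩⟩, ⟨A, hA, Or.inr ⟨D.rankOneSep hA H, H'⟩⟩]
  · rintro ⟨A, hA, ⟨H, H'⟩ | ⟨H, H'⟩⟩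
    exacts [⟨A, hA, Or.inl ⟨D.symm.nullSep hA H, H'⟩⟩,
      ⟨A, hA, Or.inr ⟨D.symm.rankOneSep hA H, H'⟩⟩]

section OneGraph

variable {E : Finset β} {t h : β → α} {A S : Finset β}

theorem mem_bdry {v : α} : v ∈ bdry E t h A ↔
    (∃ e ∈ A, t e = v ∨ h e = v) ∧ ∃ e ∈ E, e ∉ A ∧ (t e = v ∨ h e = v) := by
  simp only [bdry, Finset.mem_inter, Finset.mem_union, Finset.mem_image, Finset.mem_sdiff]
  grind

theorem bdry_sdiff (hA : A ⊆ E) : bdry E t h (E \ A) = bdry E t h A := by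
  rw [bdry, bdry, Finset.sdiff_sdiff_eq_self hA, Finset.inter_comm]

theorem IsFlow.sum_sdiff {z : β → ℝ} (hz : IsFlow E t h z) (hA : A ⊆ E) (f : α → ℝ) :
    ∑ e ∈ E \ A, z e * (f (h e) - f (t e)) = -∑ e ∈ A, z e * (f (h e) - f (t e)) := by
  rw [← add_eq_zero_iff_eq_neg, Finset.sum_sdiff hA, hz f]

theorem NullSep.sdiff (hA : A ⊆ E) (H : NullSep E t h A) : NullSep E t h (E \ A) :=
  fun f z hz => by rw [hz.sum_sdiff hA, H f z hz, neg_zero]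

theorem RankOneSep.sdiff (hA : A ⊆ E) (H : RankOneSep E t h A) : RankOneSep E t h (E \ A) :=
  fun f₁ f₂ z₁ z₂ hz₁ hz₂ => by
    simp only [hz₁.sum_sdiff hA, hz₂.sum_sdiff hA, neg_mul_neg, H f₁ f₂ z₁ z₂ hz₁ hz₂]

/-- A flow restricted to `A` pairs to zero with a potential that vanishes on the boundary. -/
theorem IsFlow.sum_eq_zero {z : β → ℝ} (hz : IsFlow E t h z) (hA : A ⊆ E) {f : α → ℝ}
    (hf : ∀ v ∈ bdry E t h A, f v = 0) : ∑ e ∈ A, z e * (f (h e) - f (t e)) = 0 := by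
  -- Cut `f` off outside the vertices of `A`. On edges outside `A` the new potential vanishes at
  -- both ends, since an end that meets `A` lies on the boundary.
  rw [← hz fun v => if ∃ e ∈ A, t e = v ∨ h e = v then f v else 0, ← Finset.sum_sdiff hA]
  have h0 : ∀ e ∈ E \ A, ∀ v, t e = v ∨ h e = v →
      (if ∃ e ∈ A, t e = v ∨ h e = v then f v else 0) = 0 := fun e he v hv => by
    rw [Finset.mem_sdiff] at he
    split_ifs with H
    · exact hf v (mem_bdry.2 ⟨H, e, he.1, he.2, hv⟩)
    · rfl
  rw [Finset.sum_eq_zero (s := E \ A) fun e he => by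
    rw [h0 e he _ (Or.inr rfl), h0 e he _ (Or.inl rfl), sub_zero, mul_zero], zero_add]
  exact Finset.sum_congr rfl fun e he => by
    rw [if_pos ⟨e, he, Or.inr rfl⟩, if_pos ⟨e, he, Or.inl rfl⟩]

/-- Shifting the potential by a constant makes it vanish on the boundary. -/
theorem nullSep_of_bdry_card_le_one (hA : A ⊆ E) (H : (bdry E t h A).card ≤ 1) :
    NullSep E t h A := fun f z hz => by
  obtain ⟨c, hc⟩ : ∃ c, ∀ v ∈ bdry E t h A, f v - c = 0 := by
    rcases (bdry E t h A).eq_empty_or_nonempty with h0 | ⟨w, hw⟩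
    · exact ⟨0, by simp [h0]⟩
    · exact ⟨f w, fun v hv => by rw [Finset.card_le_one.1 H v hv w hw, sub_self]⟩
  rw [← hz.sum_eq_zero hA hc]
  exact Finset.sum_congr rfl fun e _ => by ring

/-- With boundary `{u, v}`, the pairing is the product of `f v - f u` and a number that depends on
the flow alone. -/
theorem rankOneSep_of_bdry_card_eq_two (hA : A ⊆ E) (H : (bdry E t h A).card = 2) :
    RankOneSep E t h A := fun f₁ f₂ z₁ z₂ hz₁ hz₂ => by
  obtain ⟨u, v, huv, hb⟩ := Finset.card_eq_two.1 H
  set g : α → ℝ := fun x => if x = v then 1 else 0 with hg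
  have key : ∀ (f : α → ℝ) (z : β → ℝ), IsFlow E t h z → ∑ e ∈ A, z e * (f (h e) - f (t e)) =
      (f v - f u) * ∑ e ∈ A, z e * (g (h e) - g (t e)) := fun f z hz => by
    rw [← sub_eq_zero, ← hz.sum_eq_zero hA (f := fun x => f x - f u - (f v - f u) * g x) (by
      simp [hb, hg, huv]), Finset.mul_sum, ← Finset.sum_sub_distrib]
    exact Finset.sum_congr rfl fun e _ => by ring
  rw [key f₁ z₁ hz₁, key f₂ z₂ hz₂, key f₁ z₂ hz₂, key f₂ z₁ hz₁]
  ring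

theorem CombSplit.linearSplit (H : CombSplit E t h S) : LinearSplit E t h S := by
  obtain ⟨A, hA, ⟨H, H'⟩ | ⟨H, H'⟩⟩ := H
  · exact ⟨A, hA, Or.inl ⟨nullSep_of_bdry_card_le_one hA H, H'⟩⟩
  · exact ⟨A, hA, Or.inr ⟨rankOneSep_of_bdry_card_eq_two hA H, by omega, by omega⟩⟩

/-- Two vertices are joined by a walk in `A`. -/
def Joined (t h : β → α) (A : Finset β) : α → α → Prop :=
  Relation.EqvGen fun u v => ∃ e ∈ A, t e = u ∧ h e = v

theorem Joined.refl (v : α) : Joined t h A v v := Relation.EqvGen.refl v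

theorem Joined.symm {u v : α} (H : Joined t h A u v) : Joined t h A v u :=
  Relation.EqvGen.symm _ _ H

theorem Joined.trans {u v w : α} (H : Joined t h A u v) (H' : Joined t h A v w) :
    Joined t h A u w := Relation.EqvGen.trans _ _ _ H H'

theorem joined_edge {e : β} (he : e ∈ A) : Joined t h A (t e) (h e) :=
  Relation.EqvGen.rel _ _ ⟨e, he, rfl, rfl⟩

theorem joined_of_inc {e : β} (he : e ∈ A) {v : α} (hv : t e = v ∨ h e = v) :
    Joined t h A (t e) v := by
  rcases hv with rfl | rfl
  exacts [Joined.refl _, joined_edge he]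

/-- The edges of the component of `w` in the graph with edge set `A`. -/
noncomputable def comp (t h : β → α) (A : Finset β) (w : α) : Finset β :=
  A.filter fun e => Joined t h A (t e) w

theorem mem_comp {w : α} {e : β} : e ∈ comp t h A w ↔ e ∈ A ∧ Joined t h A (t e) w := by
  simp [comp]

theorem comp_subset (w : α) : comp t h A w ⊆ A := Finset.filter_subset _ _

/-- Dropping a component of `A` has the effect of setting the potential to zero on it, so both rank
conditions survive the removal. -/
theorem sum_sdiff_comp (w : α) (z : β → ℝ) (f : α → ℝ) :
    ∑ e ∈ A \ comp t h A w, z e * (f (h e) - f (t e)) =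
      ∑ e ∈ A, z e * ((if Joined t h A (h e) w then 0 else f (h e)) -
        (if Joined t h A (t e) w then 0 else f (t e))) := by
  rw [← Finset.sum_sdiff (comp_subset (t := t) (h := h) (A := A) w),
    Finset.sum_eq_zero (s := comp t h A w), add_zero]
  · refine Finset.sum_congr rfl fun e he => ?_
    rw [Finset.mem_sdiff, mem_comp, not_and] at he
    rw [if_neg fun H => he.2 he.1 ((joined_edge he.1).trans H), if_neg (he.2 he.1)]
  · intro e he
    rw [mem_comp] at he
    rw [if_pos ((joined_edge he.1).symm.trans he.2), if_pos he.2, sub_zero, mul_zero]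

theorem NullSep.sdiff_comp (H : NullSep E t h A) (w : α) :
    NullSep E t h (A \ comp t h A w) := fun f z hz => by
  rw [sum_sdiff_comp w z f]
  exact H (fun v => if Joined t h A v w then 0 else f v) z hz

theorem RankOneSep.sdiff_comp (H : RankOneSep E t h A) (w : α) :
    RankOneSep E t h (A \ comp t h A w) := fun f₁ f₂ z₁ z₂ hz₁ hz₂ => by
  simp only [sum_sdiff_comp w]
  exact H (fun v => if Joined t h A v w then 0 else f₁ v)
    (fun v => if Joined t h A v w then 0 else f₂ v) z₁ z₂ hz₁ hz₂

/-- The removed component shares no vertex with the rest of `A`, so no boundary vertex is created,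
while `w` disappears. This drives the inductions on the boundary size. -/
theorem bdry_sdiff_comp_subset (w : α) :
    bdry E t h (A \ comp t h A w) ⊆ (bdry E t h A).erase w := by
  intro v hv
  obtain ⟨⟨e, he, hev⟩, a, ha, haA, hav⟩ := mem_bdry.1 hv
  rw [Finset.mem_sdiff, mem_comp, not_and] at he
  have hvw : ¬ Joined t h A v w := fun H => he.2 he.1 ((joined_of_inc he.1 hev).trans H)
  refine Finset.mem_erase.2 ⟨fun H => hvw (H ▸ Joined.refl _),
    mem_bdry.2 ⟨⟨e, he.1, hev⟩, a, ha, fun haA' => ?_, hav⟩⟩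
  have : a ∈ comp t h A w := by
    by_contra hc
    exact haA (Finset.mem_sdiff.2 ⟨haA', hc⟩)
  exact hvw ((joined_of_inc haA' hav).symm.trans (mem_comp.1 this).2)

theorem card_bdry_sdiff_comp_lt {w : α} (hw : w ∈ bdry E t h A) :
    (bdry E t h (A \ comp t h A w)).card < (bdry E t h A).card :=
  (Finset.card_le_card (bdry_sdiff_comp_subset w)).trans_lt (Finset.card_erase_lt_of_mem hw)

/-- The boundary vertices in the component of `w` in the graph with edge set `A`. -/
noncomputable def cls (E : Finset β) (t h : β → α) (A : Finset β) (w : α) : Finset α :=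
  (bdry E t h A).filter fun v => Joined t h A v w

theorem bdry_comp_subset (w : α) : bdry E t h (comp t h A w) ⊆ cls E t h A w := by
  intro v hv
  obtain ⟨⟨e, he, hev⟩, a, ha, haA, hav⟩ := mem_bdry.1 hv
  have hvw : Joined t h A v w :=
    (joined_of_inc (mem_comp.1 he).1 hev).symm.trans (mem_comp.1 he).2
  exact Finset.mem_filter.2 ⟨mem_bdry.2 ⟨⟨e, (mem_comp.1 he).1, hev⟩, a, ha, fun haA' =>
    haA (mem_comp.2 ⟨haA', (joined_of_inc haA' hav).trans hvw⟩), hav⟩, hvw⟩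

/-- The boundary of the union of a component of `A` and a component of `E \ A`. -/
theorem bdry_comp_union_comp_subset (w : α) :
    bdry E t h (comp t h A w ∪ comp t h (E \ A) w) ⊆
      (cls E t h A w).erase w ∪ (cls E t h (E \ A) w).erase w := by
  intro v hv
  obtain ⟨⟨e, he, hev⟩, a, ha, haA, hav⟩ := mem_bdry.1 hv
  have hne : v ≠ w := by
    rintro rfl
    refine haA (Finset.mem_union.2 ?_)
    by_cases haA' : a ∈ A
    · exact Or.inl (mem_comp.2 ⟨haA', joined_of_inc haA' hav⟩)
    · have : a ∈ E \ A := Finset.mem_sdiff.2 ⟨ha, haA'⟩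
      exact Or.inr (mem_comp.2 ⟨this, joined_of_inc this hav⟩)
  rw [Finset.mem_union, not_or] at haA
  rcases Finset.mem_union.1 he with he | he
  · exact Finset.mem_union_left _ (Finset.mem_erase.2 ⟨hne, bdry_comp_subset w
      (mem_bdry.2 ⟨⟨e, he, hev⟩, a, ha, haA.1, hav⟩)⟩)
  · exact Finset.mem_union_right _ (Finset.mem_erase.2 ⟨hne, bdry_comp_subset w
      (mem_bdry.2 ⟨⟨e, he, hev⟩, a, ha, haA.2, hav⟩)⟩)

/-- The chain is the signed sum of the edges of a walk. -/
theorem Joined.exists_chain (hA : A ⊆ E) {u v : α} (H : Joined t h A u v) :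
    ∃ a : β → ℝ, (∀ e, e ∉ A → a e = 0) ∧
      ∀ f : α → ℝ, ∑ e ∈ E, a e * (f (h e) - f (t e)) = f u - f v := by
  induction H with
  | rel u v huv =>
    obtain ⟨e, he, rfl, rfl⟩ := huv
    refine ⟨fun a => if a = e then -1 else 0, fun a ha => if_neg (by rintro rfl; exact ha he),
      fun f => ?_⟩
    simp [ite_mul, hA he]
  | refl u => exact ⟨0, by simp, by simp⟩
  | symm u v _ ih =>
    obtain ⟨a, ha, haf⟩ := ih
    refine ⟨-a, by simpa using ha, fun f => ?_⟩
    simp [haf]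
  | trans u v w _ _ ih ih' =>
    obtain ⟨a, ha, haf⟩ := ih
    obtain ⟨b, hb, hbf⟩ := ih'
    refine ⟨a + b, fun e he => by simp [ha e he, hb e he], fun f => ?_⟩
    simp [add_mul, Finset.sum_add_distrib, haf, hbf]

/-- The classes of boundary vertices. -/
noncomputable def classes (E : Finset β) (t h : β → α) (A : Finset β) : Finset (Finset α) :=
  (bdry E t h A).image (cls E t h A)

theorem mem_cls {v w : α} : v ∈ cls E t h A w ↔ v ∈ bdry E t h A ∧ Joined t h A v w := by
  simp [cls]

theorem cls_eq_cls_iff {v w : α} (hv : v ∈ bdry E t h A) :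
    cls E t h A v = cls E t h A w ↔ Joined t h A v w := by
  constructor
  · intro H
    exact (mem_cls.1 (H ▸ mem_cls.2 ⟨hv, Joined.refl v⟩)).2
  · intro H
    ext x
    simp only [mem_cls]
    exact ⟨fun hx => ⟨hx.1, hx.2.trans H⟩, fun hx => ⟨hx.1, hx.2.trans H.symm⟩⟩

theorem sum_classes {M : Type*} [AddCommMonoid M] (F : α → M) :
    ∑ T ∈ classes E t h A, ∑ v ∈ T, F v = ∑ v ∈ bdry E t h A, F v := by
  refine Finset.sum_image' F fun w _ => Finset.sum_congr ?_ fun _ _ => rfl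
  ext v
  rw [mem_cls, Finset.mem_filter]
  exact and_congr_right fun hv => (cls_eq_cls_iff hv).symm

/-- A function on the boundary whose sum over each class is zero is the boundary of a chain. -/
theorem exists_chain_of_sum_classes_eq_zero (hA : A ⊆ E) {g : α → ℝ}
    (hg : ∀ T ∈ classes E t h A, ∑ v ∈ T, g v = 0) :
    ∃ a : β → ℝ, (∀ e, e ∉ A → a e = 0) ∧
      ∀ f : α → ℝ, ∑ e ∈ E, a e * (f (h e) - f (t e)) = ∑ v ∈ bdry E t h A, g v * f v := by
  rcases (bdry E t h A).eq_empty_or_nonempty with h0 | ⟨w₀, -⟩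
  · exact ⟨0, fun _ _ => rfl, fun f => by simp [h0]⟩
  have hrep : ∀ T : Finset α, ∃ x, ∀ v ∈ bdry E t h A, cls E t h A v = T → Joined t h A v x := by
    intro T
    by_cases H : ∃ x ∈ bdry E t h A, cls E t h A x = T
    · obtain ⟨x, hx, rfl⟩ := H
      exact ⟨x, fun v hv hvT => (cls_eq_cls_iff hv).1 hvT⟩
    · exact ⟨w₀, fun v hv hvT => absurd ⟨v, hv, hvT⟩ H⟩
  -- Every boundary vertex is connected by a chain to the representative of its class; the zero
  -- class sums make the contributions of the representatives cancel.
  choose rep hrep using hrep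
  have hch : ∀ v, ∃ a : β → ℝ, v ∈ bdry E t h A → (∀ e, e ∉ A → a e = 0) ∧
      ∀ f : α → ℝ, ∑ e ∈ E, a e * (f (h e) - f (t e)) = f v - f (rep (cls E t h A v)) := by
    intro v
    by_cases hv : v ∈ bdry E t h A
    · obtain ⟨a, ha⟩ := (hrep _ v hv rfl).exists_chain hA
      exact ⟨a, fun _ => ha⟩
    · exact ⟨0, fun H => absurd H hv⟩
  choose a ha using hch
  refine ⟨fun e => ∑ v ∈ bdry E t h A, g v * a v e, fun e he => Finset.sum_eq_zero fun v hv => by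
    rw [(ha v hv).1 e he, mul_zero], fun f => ?_⟩
  have h0 : ∑ v ∈ bdry E t h A, g v * f (rep (cls E t h A v)) = 0 := by
    rw [← sum_classes]
    refine Finset.sum_eq_zero fun T hT => ?_
    obtain ⟨w, hw, rfl⟩ := Finset.mem_image.1 hT
    rw [Finset.sum_congr rfl fun v hv => by
      rw [(cls_eq_cls_iff (mem_cls.1 hv).1).2 (mem_cls.1 hv).2], ← Finset.sum_mul, hg _ hT,
      zero_mul]
  calc _ = ∑ v ∈ bdry E t h A, g v * ∑ e ∈ E, a v e * (f (h e) - f (t e)) := by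
        simp only [Finset.sum_mul, Finset.mul_sum]
        rw [Finset.sum_comm]
        exact Finset.sum_congr rfl fun v _ => Finset.sum_congr rfl fun e _ => by ring
    _ = ∑ v ∈ bdry E t h A, (g v * f v - g v * f (rep (cls E t h A v))) :=
        Finset.sum_congr rfl fun v hv => by rw [(ha v hv).2]; ring
    _ = _ := by rw [Finset.sum_sub_distrib, h0, sub_zero]

/-- A function on the boundary whose sum over each class, on both sides, is zero, is cut out of
a flow. -/
theorem exists_flow (hA : A ⊆ E) {g : α → ℝ} (hg : ∀ T ∈ classes E t h A, ∑ v ∈ T, g v = 0)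
    (hg' : ∀ T ∈ classes E t h (E \ A), ∑ v ∈ T, g v = 0) :
    ∃ z, IsFlow E t h z ∧
      ∀ f : α → ℝ, ∑ e ∈ A, z e * (f (h e) - f (t e)) = ∑ v ∈ bdry E t h A, g v * f v := by
  obtain ⟨a, ha, haf⟩ := exists_chain_of_sum_classes_eq_zero hA hg
  obtain ⟨b, hb, hbf⟩ := exists_chain_of_sum_classes_eq_zero (Finset.sdiff_subset) hg'
  rw [bdry_sdiff hA] at hbf
  refine ⟨a - b, fun f => ?_, fun f => ?_⟩
  · simp [sub_mul, Finset.sum_sub_distrib, haf, hbf]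
  · rw [← haf, ← Finset.sum_sdiff hA, Finset.sum_eq_zero (s := E \ A) fun e he => by
      rw [ha e (Finset.mem_sdiff.1 he).2, zero_mul], zero_add]
    exact Finset.sum_congr rfl fun e he => by
      rw [Pi.sub_apply, hb e fun H => (Finset.mem_sdiff.1 H).2 he, sub_zero]

/-- Fewer linear conditions than unknowns. -/
theorem exists_ne_zero_of_card_lt (W : Finset α) (𝓕 : Finset (Finset α))
    (hc : 𝓕.card < W.card) :
    ∃ g : α → ℝ, (∃ w ∈ W, g w ≠ 0) ∧ ∀ T ∈ 𝓕, ∑ v ∈ T, g v = 0 := by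
  let ext : (W → ℝ) →ₗ[ℝ] (α → ℝ) := Function.ExtendByZero.linearMap ℝ Subtype.val
  let L : (W → ℝ) →ₗ[ℝ] (𝓕 → ℝ) := LinearMap.pi fun T =>
    (∑ v ∈ T.1, LinearMap.proj v) ∘ₗ ext
  have hL : LinearMap.ker L ≠ ⊥ := LinearMap.ker_ne_bot_of_finrank_lt (by simpa using hc)
  obtain ⟨x, hx, hx0⟩ := (Submodule.ne_bot_iff _).1 hL
  refine ⟨ext x, ?_, fun T hT => ?_⟩
  · by_contra! H
    refine hx0 (funext fun w => ?_)
    have := H w.1 w.2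
    simpa [ext, Subtype.val_injective.extend_apply] using this
  · have := congrFun (LinearMap.mem_ker.1 hx) ⟨T, hT⟩
    simpa [L] using this

end OneGraph

end Separations

/-! ### From rank conditions back to separations of small order. -/

section LinearToComb

open Classical

variable {α β φ : Type*} {E : Finset β} {t h : β → α} {A S : Finset β}

/-- Two walks from `u` to `v`, one on each side, form a flow; over `A` it pairs to 1 with the
indicator of `u` if `u ≠ v`. -/
theorem NullSep.joined (hA : A ⊆ E) (H : NullSep E t h A) {u v : α}
    (hu : Joined t h A u v) (hu' : Joined t h (E \ A) u v) : u = v := by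
  obtain ⟨a, ha, haf⟩ := hu.exists_chain hA
  obtain ⟨b, hb, hbf⟩ := hu'.exists_chain (Finset.sdiff_subset)
  have := H (fun x => if x = u then 1 else 0) (a - b) fun f => by
    simp [sub_mul, Finset.sum_sub_distrib, haf, hbf]
  have h2 := haf fun x => if x = u then 1 else 0
  rw [← Finset.sum_sdiff hA, Finset.sum_eq_zero (s := E \ A) fun e he => by
    rw [ha e (Finset.mem_sdiff.1 he).2, zero_mul], zero_add, Finset.sum_congr rfl fun e he => by
    rw [show a e = (a - b) e by
      rw [Pi.sub_apply, hb e fun H => (Finset.mem_sdiff.1 H).2 he, sub_zero]], this] at h2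
  by_contra huv
  simp [Ne.symm huv] at h2

/-- If an edge of `S` on one side avoids the component of some boundary vertex, that component can
change sides, which shrinks the boundary. Otherwise, on either side, all boundary vertices lie in
one component, and `NullSep.joined` makes them equal. -/
theorem exists_bdry_card_le_one (hA : A ⊆ E) (H : NullSep E t h A) (h₁ : (A ∩ S).Nonempty)
    (h₂ : ((E \ A) ∩ S).Nonempty) :
    ∃ A ⊆ E, (bdry E t h A).card ≤ 1 ∧ (A ∩ S).Nonempty ∧ ((E \ A) ∩ S).Nonempty := by
  induction hn : (bdry E t h A).card using Nat.strong_induction_on generalizing A with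
  | _ n ih =>
  subst hn
  by_contra hno
  have key : ∀ B ⊆ E, NullSep E t h B → (B ∩ S).Nonempty → ((E \ B) ∩ S).Nonempty →
      bdry E t h B = bdry E t h A → ∀ w ∈ bdry E t h A, ∀ e ∈ B ∩ S, e ∈ comp t h B w := by
    intro B hB HB hB1 hB2 hBA w hw e he
    by_contra hec
    rw [Finset.mem_inter] at he
    refine hno (ih _ (hBA ▸ card_bdry_sdiff_comp_lt (hBA ▸ hw))
      (Finset.sdiff_subset.trans hB) (HB.sdiff_comp w)
      ⟨e, by simp [he, hec]⟩ (hB2.mono ?_) rfl)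
    exact Finset.inter_subset_inter_right (Finset.sdiff_subset_sdiff subset_rfl
      Finset.sdiff_subset)
  refine hno ⟨A, hA, Finset.card_le_one.2 fun u hu v hv => ?_, h₁, h₂⟩
  refine H.joined hA ?_ ?_
  · obtain ⟨e, he⟩ := h₁
    have := key A hA H ⟨e, he⟩ h₂ rfl
    exact (mem_comp.1 (this u hu e he)).2.symm.trans (mem_comp.1 (this v hv e he)).2
  · obtain ⟨e, he⟩ := h₂
    have := key (E \ A) Finset.sdiff_subset (H.sdiff hA) ⟨e, he⟩
      (by rwa [Finset.sdiff_sdiff_eq_self hA]) (bdry_sdiff hA)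
    exact (mem_comp.1 (this u hu e he)).2.symm.trans (mem_comp.1 (this v hv e he)).2

/-- Boundary functions with zero sum on every class of both sides come from flows. The class
conditions have one redundancy, as the classes of each side partition the boundary. So a larger
boundary would leave two independent such functions, hence rank two. -/
theorem RankOneSep.card_bdry_le (hA : A ⊆ E) (H : RankOneSep E t h A) :
    (bdry E t h A).card ≤ (classes E t h A).card + (classes E t h (E \ A)).card := by
  by_contra! hlt
  have hne : (bdry E t h A).Nonempty := Finset.card_pos.1 (by omega)
  obtain ⟨w₀, hw₀⟩ := hne
  obtain ⟨g₁, ⟨w₁, hw₁, hg₁⟩, hg₁T⟩ := exists_ne_zero_of_card_lt (bdry E t h A)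
    (classes E t h A ∪ classes E t h (E \ A)) ((Finset.card_union_le _ _).trans_lt hlt)
  set T₀ := cls E t h (E \ A) w₀
  have hT₀ : T₀ ∈ classes E t h (E \ A) := Finset.mem_image_of_mem _ (by rwa [bdry_sdiff hA])
  have hc := Finset.card_erase_add_one hT₀
  -- The condition for `T₀` follows from the others, so it is traded for `g₂ w₁ = 0`. This makes the
  -- 2 × 2 pairing matrix at `w₁`, `w₂` triangular with nonzero diagonal.
  obtain ⟨g₂, ⟨w₂, hw₂, hg₂⟩, hg₂T⟩ := exists_ne_zero_of_card_lt (bdry E t h A)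
    (classes E t h A ∪ ((classes E t h (E \ A)).erase T₀ ∪ {{w₁}})) (by
      refine (Finset.card_union_le _ _).trans_lt (lt_of_le_of_lt (Nat.add_le_add_left
        (Finset.card_union_le _ _) _) ?_)
      rw [Finset.card_singleton]
      omega)
  have h2T : ∀ T ∈ classes E t h (E \ A), ∑ v ∈ T, g₂ v = 0 := by
    intro T hT
    by_cases hTT : T = T₀
    · have e1 := sum_classes (E := E) (t := t) (h := h) (A := E \ A) g₂
      rw [bdry_sdiff hA, ← sum_classes, Finset.sum_eq_zero (s := classes E t h A) fun T hT =>
        hg₂T T (Finset.mem_union_left _ hT), ← Finset.add_sum_erase _ _ hT₀,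
        Finset.sum_eq_zero fun T hT => hg₂T T (Finset.mem_union_right _
          (Finset.mem_union_left _ hT)), add_zero] at e1
      rw [hTT, e1]
    · exact hg₂T T (by simp [hT, hTT])
  have h2w : g₂ w₁ = 0 := by simpa using hg₂T {w₁} (by simp)
  obtain ⟨z₁, hz₁, hz₁f⟩ := exists_flow hA (fun T hT => hg₁T T (Finset.mem_union_left _ hT))
    (fun T hT => hg₁T T (Finset.mem_union_right _ hT))
  obtain ⟨z₂, hz₂, hz₂f⟩ := exists_flow hA (fun T hT => hg₂T T (Finset.mem_union_left _ hT)) h2T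
  have := H (Pi.single w₁ 1) (Pi.single w₂ 1) z₁ z₂ hz₁ hz₂
  rw [hz₁f, hz₂f, hz₁f, hz₂f] at this
  simp [Pi.single_apply, hw₁, hw₂, h2w, hg₁, hg₂] at this

/-- The classes of either side partition the boundary into parts of size at least 2, so each side
has at most half as many classes as boundary vertices; `hle` forces equality. -/
theorem card_cls_eq_two (hA : A ⊆ E)
    (hle : (bdry E t h A).card ≤ (classes E t h A).card + (classes E t h (E \ A)).card)
    (h₁ : ∀ w ∈ bdry E t h A, 2 ≤ (cls E t h A w).card)
    (h₂ : ∀ w ∈ bdry E t h A, 2 ≤ (cls E t h (E \ A) w).card) :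
    ∀ w ∈ bdry E t h A, (cls E t h A w).card = 2 := by
  have aux : ∀ B : Finset β, (∀ w ∈ bdry E t h B, 2 ≤ (cls E t h B w).card) →
      2 * (classes E t h B).card ≤ (bdry E t h B).card := by
    intro B hB
    rw [Finset.card_eq_sum_ones (bdry E t h B), ← sum_classes, mul_comm, ← smul_eq_mul]
    refine Finset.card_nsmul_le_sum _ _ _ fun T hT => ?_
    obtain ⟨w, hw, rfl⟩ := Finset.mem_image.1 hT
    simpa using hB w hw
  have a₂ := aux (E \ A) (by rwa [bdry_sdiff hA])
  rw [bdry_sdiff hA] at a₂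
  have a₁ := aux A h₁
  have hsum := sum_classes (E := E) (t := t) (h := h) (A := A) fun _ => 1
  simp only [← Finset.card_eq_sum_ones] at hsum
  have hle' : ∀ T ∈ classes E t h A, 2 ≤ T.card := by
    intro T hT
    obtain ⟨w, hw, rfl⟩ := Finset.mem_image.1 hT
    exact h₁ w hw
  have heq : ∑ T ∈ classes E t h A, 2 = ∑ T ∈ classes E t h A, T.card := by
    rw [hsum, Finset.sum_const, smul_eq_mul]
    omega
  intro w hw
  exact ((Finset.sum_eq_sum_iff_of_le hle').1 heq _ (Finset.mem_image_of_mem _ hw)).symm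

theorem combSplit_of_bdry_card_le_two (hA : A ⊆ E) (hS : (E ∩ S).card ≤ 5)
    (hb : (bdry E t h A).card ≤ 2) (h₁ : 2 ≤ (A ∩ S).card) (h₂ : 2 ≤ ((E \ A) ∩ S).card) :
    CombSplit E t h S := by
  have hcard : (A ∩ S).card + ((E \ A) ∩ S).card = (E ∩ S).card := by
    rw [← Finset.card_union_of_disjoint]
    · rw [← Finset.union_inter_distrib_right, Finset.union_sdiff_of_subset hA]
    · exact Finset.disjoint_sdiff.mono Finset.inter_subset_left Finset.inter_subset_left
  refine ⟨A, hA, ?_⟩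
  by_cases hb' : (bdry E t h A).card ≤ 1
  · exact Or.inl ⟨hb', Finset.card_pos.1 (by omega), Finset.card_pos.1 (by omega)⟩
  · exact Or.inr ⟨by omega, by omega⟩

/-- In a counterexample with minimal boundary, each component at the boundary has an edge of `S` and
at least two boundary vertices. By counting it has exactly two, and then exactly one edge of `S`.
Two components from opposite sides that share a vertex `w` then form a part with two edges of `S`
and at most two boundary vertices. -/
theorem RankOneSep.combSplit (hA : A ⊆ E) (H : RankOneSep E t h A) (hS : (E ∩ S).card ≤ 5)
    (h₁ : 2 ≤ (A ∩ S).card) (h₂ : 2 ≤ ((E \ A) ∩ S).card) : CombSplit E t h S := by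
  induction hn : (bdry E t h A).card using Nat.strong_induction_on generalizing A with
  | _ n ih =>
  subst hn
  have hcard : ∀ B ⊆ E, (B ∩ S).card + ((E \ B) ∩ S).card = (E ∩ S).card := by
    intro B hB
    rw [← Finset.card_union_of_disjoint]
    · rw [← Finset.union_inter_distrib_right, Finset.union_sdiff_of_subset hB]
    · exact Finset.disjoint_sdiff.mono Finset.inter_subset_left Finset.inter_subset_left
  by_contra hno
  -- every component that meets the boundary has exactly one edge of `S` and has degree at least 2
  have key : ∀ B ⊆ E, RankOneSep E t h B → 2 ≤ (B ∩ S).card → 2 ≤ ((E \ B) ∩ S).card →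
      bdry E t h B = bdry E t h A → ∀ w ∈ bdry E t h A,
      2 ≤ (cls E t h B w).card ∧ 1 ≤ (comp t h B w ∩ S).card ∧
        ((cls E t h B w).card = 2 → (comp t h B w ∩ S).card = 1) := by
    intro B hB HB hB1 hB2 hBA w hw
    have hcE : comp t h B w ⊆ E := (comp_subset w).trans hB
    have hmono : ((E \ B) ∩ S).card ≤ ((E \ comp t h B w) ∩ S).card := Finset.card_le_card
      (Finset.inter_subset_inter_right (Finset.sdiff_subset_sdiff subset_rfl (comp_subset w)))
    have hpos : 1 ≤ (comp t h B w ∩ S).card := by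
      by_contra! h0
      rw [Nat.lt_one_iff, Finset.card_eq_zero] at h0
      have hBS : (B \ comp t h B w) ∩ S = B ∩ S := by
        ext e
        have : e ∉ comp t h B w ∩ S := by simp [h0]
        simp only [Finset.mem_inter, Finset.mem_sdiff] at this ⊢
        tauto
      have hBE : B \ comp t h B w ⊆ E := Finset.sdiff_subset.trans hB
      have c1 := hcard B hB
      have c2 := hcard _ hBE
      rw [hBS] at c2
      exact hno (ih _ (hBA ▸ card_bdry_sdiff_comp_lt (hBA ▸ hw)) hBE (HB.sdiff_comp w)
        (by rwa [hBS]) (by omega) rfl)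
    have hbc := Finset.card_le_card (bdry_comp_subset (E := E) (t := t) (h := h) (A := B) w)
    refine ⟨?_, hpos, fun h2 => ?_⟩
    · by_contra! hlt
      exact hno ⟨_, hcE, Or.inl ⟨by omega, Finset.card_pos.1 (by omega),
        Finset.card_pos.1 (by omega)⟩⟩
    · by_contra hne
      exact hno (combSplit_of_bdry_card_le_two hcE hS (by omega) (by omega) (by omega))
  have k₁ := key A hA H h₁ h₂ rfl
  have hA' : E \ A ⊆ E := Finset.sdiff_subset
  have hAA : E \ (E \ A) = A := Finset.sdiff_sdiff_eq_self hA
  have k₂ := key (E \ A) hA' (H.sdiff hA) h₂ (by rwa [hAA]) (bdry_sdiff hA)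
  have hle := H.card_bdry_le hA
  have c₁ := card_cls_eq_two hA hle (fun w hw => (k₁ w hw).1) (fun w hw => (k₂ w hw).1)
  have c₂ := card_cls_eq_two hA' (by rw [hAA, bdry_sdiff hA]; omega)
    (fun w hw => (k₂ w (by rwa [bdry_sdiff hA] at hw)).1)
    (fun w hw => by rw [hAA]; exact (k₁ w (by rwa [bdry_sdiff hA] at hw)).1)
  rw [bdry_sdiff hA] at c₂
  by_cases hb : (bdry E t h A).card ≤ 2
  · exact hno (combSplit_of_bdry_card_le_two hA hS hb h₁ h₂)
  obtain ⟨w, hw⟩ : (bdry E t h A).Nonempty := Finset.card_pos.1 (by omega)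
  have hXE : comp t h A w ∪ comp t h (E \ A) w ⊆ E :=
    Finset.union_subset ((comp_subset w).trans hA) ((comp_subset w).trans hA')
  have hX : ((comp t h A w ∪ comp t h (E \ A) w) ∩ S).card = 2 := by
    rw [Finset.union_inter_distrib_right, Finset.card_union_of_disjoint, (k₁ w hw).2.2 (c₁ w hw),
      (k₂ w hw).2.2 (c₂ w hw)]
    exact Finset.disjoint_sdiff.mono (Finset.inter_subset_left.trans (comp_subset w))
      (Finset.inter_subset_left.trans (comp_subset w))
  have hXb : (bdry E t h (comp t h A w ∪ comp t h (E \ A) w)).card ≤ 2 := by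
    refine (Finset.card_le_card (bdry_comp_union_comp_subset w)).trans
      ((Finset.card_union_le _ _).trans ?_)
    rw [Finset.card_erase_of_mem (mem_cls.2 ⟨hw, Joined.refl w⟩),
      Finset.card_erase_of_mem (mem_cls.2 ⟨by rwa [bdry_sdiff hA], Joined.refl w⟩),
      c₁ w hw, c₂ w hw]
  have e1 := hcard _ hXE
  have e2 := hcard A hA
  exact hno (combSplit_of_bdry_card_le_two hXE hS hXb (by omega) (by omega))

theorem combSplit_iff_linearSplit (hS : (E ∩ S).card ≤ 5) :
    CombSplit E t h S ↔ LinearSplit E t h S := by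
  refine ⟨CombSplit.linearSplit, ?_⟩
  rintro ⟨A, hA, ⟨H, h₁, h₂⟩ | ⟨H, h₁, h₂⟩⟩
  · obtain ⟨A', hA', H'⟩ := exists_bdry_card_le_one hA H h₁ h₂
    exact ⟨A', hA', Or.inl H'⟩
  · exact H.combSplit hA hS h₁ h₂

end LinearToComb

/-! ### Translation to graphs, deletion and contraction. -/

section Graphs

open Classical

variable {α β φ : Type*}

theorem Orients.edgeVerts_eq {G : Graph α β} {t h : β → α} (o : Orients G t h) {A : Finset β}
    (hA : (A : Set β) ⊆ E(G)) : edgeVerts G A = (A.image t ∪ A.image h : Finset α) := by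
  ext v
  simp only [edgeVerts, Set.mem_ofPred_eq, Finset.mem_coe, Finset.mem_union, Finset.mem_image]
  constructor
  · rintro ⟨e, he, x, hx⟩
    rcases (o.isLink_iff (hA he) _ _).1 hx with ⟨rfl, -⟩ | ⟨rfl, -⟩
    exacts [Or.inl ⟨e, he, rfl⟩, Or.inr ⟨e, he, rfl⟩]
  · rintro (⟨e, he, rfl⟩ | ⟨e, he, rfl⟩)
    exacts [⟨e, he, (o e (hA he)).inc_left⟩, ⟨e, he, (o e (hA he)).inc_right⟩]

theorem Orients.hasSplittingSeparation_iff {G : Graph α β} {t h : β → α} (o : Orients G t h)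
    {E : Finset β} (hE : (E : Set β) = E(G)) (S : Finset β) :
    HasSplittingSeparation G S ↔ CombSplit E t h S := by
  have ho : ∀ A ⊆ E, sepOrder G A ↑(E \ A) = (bdry E t h A).card := by
    intro A hA
    have h1 : (A : Set β) ⊆ E(G) := hE ▸ Finset.coe_subset.2 hA
    have h2 : ((E \ A : Finset β) : Set β) ⊆ E(G) := hE ▸ Finset.coe_subset.2 Finset.sdiff_subset
    rw [sepOrder, o.edgeVerts_eq h1, o.edgeVerts_eq h2, ← Finset.coe_inter,
      Set.ncard_coe_finset, bdry]
  constructor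
  · rintro ⟨A, B, ⟨hAB, hABE⟩, H⟩
    have hAE : A ⊆ E := by rw [hE, ← hABE]; exact Set.subset_union_left
    lift A to Finset β using E.finite_toSet.subset hAE
    have hA : A ⊆ E := Finset.coe_subset.1 hAE
    obtain rfl : B = ↑(E \ A) := by
      rw [Finset.coe_sdiff, hE, ← hABE, Set.union_sdiff_left, eq_comm, sdiff_eq_left,
        Set.disjoint_iff_inter_eq_empty, Set.inter_comm, hAB]
    rw [ho A hA, ← Finset.coe_inter, ← Finset.coe_inter, Finset.coe_nonempty, Finset.coe_nonempty,
      Set.ncard_coe_finset, Set.ncard_coe_finset] at H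
    exact ⟨A, hA, H⟩
  · rintro ⟨A, hA, H⟩
    refine ⟨A, ↑(E \ A), ⟨?_, ?_⟩, ?_⟩
    · rw [Finset.coe_sdiff, Set.inter_sdiff_self]
    · rw [Finset.coe_sdiff, Set.union_sdiff_cancel (Finset.coe_subset.2 hA), hE]
    · rwa [ho A hA, ← Finset.coe_inter, ← Finset.coe_inter, Finset.coe_nonempty,
        Finset.coe_nonempty, Set.ncard_coe_finset, Set.ncard_coe_finset]

theorem DualPair.hasSplittingSeparation_iff {G : Graph α β} {G' : Graph φ β} {t h : β → α}
    {t' h' : β → φ} {E : Finset β} (D : DualPair E t h t' h') (o : Orients G t h)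
    (o' : Orients G' t' h') (hE : (E : Set β) = E(G)) (hE' : (E : Set β) = E(G'))
    {S : Finset β} (hS : S.card ≤ 5) :
    HasSplittingSeparation G S ↔ HasSplittingSeparation G' S := by
  have hS' : (E ∩ S).card ≤ 5 := (Finset.card_le_card Finset.inter_subset_right).trans hS
  rw [o.hasSplittingSeparation_iff hE, o'.hasSplittingSeparation_iff hE',
    combSplit_iff_linearSplit hS', combSplit_iff_linearSplit hS', D.linearSplit_iff]

theorem DualPair.hasSplittingSeparation_delete_iff {G : Graph α β} {G' : Graph φ β}
    {t h : β → α} {t' h' : β → φ} {E : Finset β} (D : DualPair E t h t' h')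
    (o : Orients G t h) (o' : Orients G' t' h') (hE : (E : Set β) = E(G))
    (hE' : (E : Set β) = E(G')) {S : Finset β} (hS : S.card ≤ 5) {e : β} (he : e ∈ E) :
    HasSplittingSeparation (G.deleteEdges {e}) S ↔
      HasSplittingSeparation (contractEdge G' e) S := by
  have he' : e ∈ E(G') := hE' ▸ he
  refine (D.delete_contract he (r := G'.IsLink e) fun x y => o'.isLink_iff he' x y)
    |>.hasSplittingSeparation_iff (o.deleteEdges {e}) (o'.contractEdge e) ?_ ?_ hS
  · simp [hE]
  · simp [contractEdge, hE']

theorem DualPair.configSplits_iff {H : EnhancedGraph α β} {H' : EnhancedGraph φ β}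
    {t h : β → α} {t' h' : β → φ} {E : Finset β} (D : DualPair E t h t' h')
    (o : Orients H.graph t h) (o' : Orients H'.graph t' h') (hE : (E : Set β) = E(H.graph))
    (hE' : (E : Set β) = E(H'.graph)) (hC : H'.contractProof = H.deleteProof)
    (hD : H'.deleteProof = H.contractProof) {S : Finset β} (hS : S.card ≤ 5) (hSE : S ⊆ E) :
    H.ConfigSplits S ↔ H'.ConfigSplits S := by
  unfold EnhancedGraph.ConfigSplits
  rw [D.hasSplittingSeparation_iff o o' hE hE' hS, hC, hD]
  refine or_congr Iff.rfl (Iff.trans or_comm (or_congr ?_ ?_))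
  · exact exists_congr fun e => and_congr_right fun he =>
      (D.symm.hasSplittingSeparation_delete_iff o' o hE' hE hS (hSE he.1)).symm
  · exact exists_congr fun e => and_congr_right fun he =>
      D.hasSplittingSeparation_delete_iff o o' hE hE' hS (hSE he.1)

end Graphs

/-! ### Plane duality as a dual pair. -/

section PlanarDuality

open Classical

variable {α β φ : Type*} {G : Graph α β}

theorem Drawing.tail_rot_symm (P : Drawing G φ) (d : Dart G) : P.tail (P.rot.symm d) = P.tail d :=
  (P.sameCycle_rot _ _).1 ⟨1, by simp⟩

theorem Drawing.face_rot_symm (P : Drawing G φ) (d : Dart G) :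
    P.face (P.rot.symm d) = P.face (Dart.rev d) := by
  simpa [Dart.rev] using P.face_next (Dart.rev d)

/-- Potential differences of a drawn graph are orthogonal to potential differences of its dual. -/
theorem Drawing.sum_mul_eq_zero (P : Drawing G φ) [Fintype E(G)] (f : α → ℝ) (g : φ → ℝ) :
    ∑ e : E(G), (f (P.tail (e, true)) - f (P.tail (e, false))) *
      (g (P.face (e, true)) - g (P.face (e, false))) = 0 := by
  -- Reindexing by `rot⁻¹` preserves tails and turns the face on the left of a dart into the face on
  -- its right, so the two halves cancel.
  have h1 : ∑ d : Dart G, f (P.tail d) * (g (P.face d) - g (P.face (Dart.rev d))) = 0 := by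
    simp only [mul_sub, Finset.sum_sub_distrib]
    rw [sub_eq_zero, ← Equiv.sum_comp P.rot.symm fun d : Dart G => f (P.tail d) * g (P.face d)]
    exact Finset.sum_congr rfl fun d _ => by rw [P.tail_rot_symm, P.face_rot_symm]
  rw [← h1, Fintype.sum_prod_type]
  refine Finset.sum_congr rfl fun e _ => ?_
  rw [Fintype.sum_bool]
  simp only [Dart.rev, Bool.not_true, Bool.not_false]
  ring

/-- The map that takes a potential to its differences along the edges. -/
def coboundary {ι V : Type*} (t h : ι → V) : (V → ℝ) →ₗ[ℝ] (ι → ℝ) where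
  toFun f e := f (h e) - f (t e)
  map_add' f g := by ext; simp; ring
  map_smul' c f := by ext; simp; ring

theorem coboundary_apply {ι V : Type*} (t h : ι → V) (f : V → ℝ) (e : ι) :
    coboundary t h f e = f (h e) - f (t e) := rfl

/-- The differences are bounded below in rank by the number of vertices minus the number of classes
on which potentials with zero differences are constant. -/
theorem card_le_finrank_range_coboundary {ι V Q : Type*} [Finite V] [Finite Q] (t h : ι → V)
    (q : V → Q) (hq : ∀ f : V → ℝ, (∀ e, f (t e) = f (h e)) → ∀ v w, q v = q w → f v = f w) :
    Nat.card V ≤ Module.finrank ℝ (LinearMap.range (coboundary t h)) + Nat.card Q := by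
  have := Fintype.ofFinite V
  have := Fintype.ofFinite Q
  have hk : Module.finrank ℝ (LinearMap.ker (coboundary t h)) ≤ Nat.card Q := by
    have hle : LinearMap.ker (coboundary t h) ≤ LinearMap.range (LinearMap.funLeft ℝ ℝ q) := by
      intro f hf
      have hf' : ∀ e, f (t e) = f (h e) := fun e => by
        have := congrFun (LinearMap.mem_ker.1 hf) e
        rw [coboundary_apply, Pi.zero_apply, sub_eq_zero] at this
        exact this.symm
      refine ⟨fun x => if hx : ∃ v, q v = x then f hx.choose else 0, ?_⟩
      ext v
      have hx : ∃ w, q w = q v := ⟨v, rfl⟩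
      rw [LinearMap.funLeft_apply, dif_pos hx]
      exact hq f hf' _ _ hx.choose_spec
    refine (Submodule.finrank_mono hle).trans ((LinearMap.finrank_range_le _).trans ?_)
    rw [Module.finrank_fintype_fun_eq_card, Nat.card_eq_fintype_card]
  have := (coboundary t h).finrank_range_add_finrank_ker
  rw [Module.finrank_fintype_fun_eq_card, ← Nat.card_eq_fintype_card] at this
  omega

/-- If `C` and `C'` are orthogonal and their dimensions add up to at least `|ι|`, then
everything orthogonal to `C` is in `C'`. -/
theorem mem_of_orthogonal {ι : Type*} [Fintype ι] {C C' : Submodule ℝ (ι → ℝ)}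
    (horth : ∀ x ∈ C, ∀ y ∈ C', ∑ e, x e * y e = 0)
    (hdim : Fintype.card ι ≤ Module.finrank ℝ C + Module.finrank ℝ C') {z : ι → ℝ}
    (hz : ∀ x ∈ C, ∑ e, x e * z e = 0) : z ∈ C' := by
  -- In Euclidean space the orthogonal complement of `C` has dimension `|ι| - dim C`, so it cannot
  -- exceed `C'`.
  let L := (WithLp.linearEquiv 2 ℝ (ι → ℝ)).symm
  let D := C.map L.toLinearMap
  let D' := C'.map L.toLinearMap
  have hin : ∀ x y : ι → ℝ, inner ℝ (L x) (L y) = ∑ e, x e * y e := fun x y => by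
    simp [L, PiLp.inner_apply, mul_comm]
  have hle : D' ≤ Dᗮ := by
    rintro _ ⟨y, hy, rfl⟩
    rw [Submodule.mem_orthogonal]
    rintro _ ⟨x, hx, rfl⟩
    exact (hin x y).trans (horth x hx y hy)
  have e1 : Module.finrank ℝ D = Module.finrank ℝ C := LinearEquiv.finrank_map_eq L C
  have e2 : Module.finrank ℝ D' = Module.finrank ℝ C' := LinearEquiv.finrank_map_eq L C'
  have e3 := D.finrank_add_finrank_orthogonal
  rw [finrank_euclideanSpace] at e3
  have heq : D' = Dᗮ := Submodule.eq_of_le_of_finrank_le hle (by omega)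
  have hzD : L z ∈ D' := by
    rw [heq, Submodule.mem_orthogonal]
    rintro _ ⟨x, hx, rfl⟩
    exact (hin x z).trans (hz x hx)
  obtain ⟨y, hy, hyz⟩ := hzD
  rwa [← L.injective hyz]

theorem eq_of_reflTransGen {f : α → ℝ} (hf : ∀ e x y, G.IsLink e x y → f x = f y) {x y : α}
    (hxy : Relation.ReflTransGen G.Adj x y) : f x = f y := by
  induction hxy with
  | refl => rfl
  | tail _ h ih =>
    obtain ⟨e, he⟩ := h
    exact ih.trans (hf e _ _ he)

theorem PlaneEmbedding.dualPair (P : PlaneEmbedding G φ) (hV : V(G).Finite) {E : Finset β}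
    (hE : (E : Set β) = E(G)) {t h : β → α} {t' h' : β → φ}
    (ht : ∀ e : E(G), t e = P.tail (e, false)) (hh : ∀ e : E(G), h e = P.tail (e, true))
    (ht' : ∀ e : E(G), t' e = P.face (e, false)) (hh' : ∀ e : E(G), h' e = P.face (e, true)) :
    DualPair E t h t' h' := by
  have hmem : ∀ e, e ∈ E ↔ e ∈ E(G) := fun e => by rw [← hE, Finset.mem_coe]
  let _ : Fintype E(G) := Fintype.subtype E hmem
  have hsum : ∀ F : β → ℝ, ∑ e ∈ E, F e = ∑ e : E(G), F e := fun F =>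
    Finset.sum_subtype E hmem F
  have : Finite V(G) := hV
  have : Finite φ := P.finite_faces
  have : Finite (Component G) := Quot.finite _
  have horth : ∀ (f : α → ℝ) (g : φ → ℝ),
      ∑ e ∈ E, (f (h e) - f (t e)) * (g (h' e) - g (t' e)) = 0 := fun f g => by
    rw [hsum, ← P.sum_mul_eq_zero f g]
    exact Finset.sum_congr rfl fun e _ => by rw [ht, hh, ht', hh']
  have htV : ∀ e : E(G), t e ∈ V(G) := fun e => ht e ▸ (P.isLink_tail e).left_mem
  have hhV : ∀ e : E(G), h e ∈ V(G) := fun e => hh e ▸ (P.isLink_tail e).right_mem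
  -- The type `α` may be infinite, so ranks are computed with potentials on `V(G)`, which extend by
  -- zero.
  let tV : E(G) → V(G) := fun e => ⟨t e, htV e⟩
  let hV : E(G) → V(G) := fun e => ⟨h e, hhV e⟩
  let C := LinearMap.range (coboundary tV hV)
  let C' := LinearMap.range (coboundary (fun e : E(G) => t' e) fun e : E(G) => h' e)
  have ext : ∀ f : V(G) → ℝ, ∃ f' : α → ℝ, ∀ v : V(G), f' v = f v := fun f =>
    ⟨fun v => if hv : v ∈ V(G) then f ⟨v, hv⟩ else 0, fun v => by simp⟩
  have hCC : ∀ x ∈ C, ∀ y ∈ C', ∑ e, x e * y e = 0 := by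
    rintro _ ⟨f, rfl⟩ _ ⟨g, rfl⟩
    obtain ⟨f', hf'⟩ := ext f
    rw [← horth f' g, hsum]
    exact Finset.sum_congr rfl fun e _ => by
      rw [coboundary_apply, coboundary_apply, ← hf', ← hf']
  have d1 : Nat.card V(G) ≤ Module.finrank ℝ C + Nat.card (Component G) := by
    refine card_le_finrank_range_coboundary tV hV (Quot.mk _) fun f hf v w hvw => ?_
    have hadj : ∀ v w : V(G), G.Adj v w → f v = f w := by
      rintro v w ⟨e, he⟩
      have hfe := hf ⟨e, he.edge_mem⟩
      have hl := P.isLink_tail ⟨e, he.edge_mem⟩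
      rw [← ht, ← hh] at hl
      rcases he.eq_and_eq_or_eq_and_eq hl with ⟨h1, h2⟩ | ⟨h1, h2⟩
      · exact (congrArg f (Subtype.ext h1)).trans (hfe.trans (congrArg f (Subtype.ext h2)).symm)
      · exact (congrArg f (Subtype.ext h1)).trans
          (hfe.symm.trans (congrArg f (Subtype.ext h2)).symm)
    have := congrArg (Quot.lift f hadj) hvw
    exact this
  have d2 : Nat.card φ ≤ Module.finrank ℝ C' + Nat.card Unit := by
    refine card_le_finrank_range_coboundary _ _ (fun _ => ()) fun f hf v w _ => ?_
    refine eq_of_reflTransGen (G := P.dual) ?_ (P.dual_connected.2 v trivial w trivial)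
    rintro _ _ _ ⟨⟨e, b⟩, rfl, rfl, rfl⟩
    have := hf e
    rw [ht', hh'] at this
    cases b
    exacts [this, this.symm]
  have hdim : Fintype.card E(G) ≤ Module.finrank ℝ C + Module.finrank ℝ C' := by
    have := P.euler
    rw [Nat.card_eq_fintype_card (α := E(G))] at this
    rw [Nat.card_unique (α := Unit)] at d2
    omega
  refine ⟨horth, fun z hz => ?_, fun z hz => ?_⟩
  · have hzC : (fun e : E(G) => z e) ∈ C' := by
      refine mem_of_orthogonal hCC hdim ?_
      rintro _ ⟨f, rfl⟩
      obtain ⟨f', hf'⟩ := ext f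
      rw [← hz f', hsum]
      exact Finset.sum_congr rfl fun e _ => by rw [coboundary_apply, ← hf', ← hf', mul_comm]
    obtain ⟨g, hg⟩ := hzC
    exact ⟨g, fun e he => (congrFun hg ⟨e, (hmem e).1 he⟩).symm⟩
  · have hzC : (fun e : E(G) => z e) ∈ C := by
      refine mem_of_orthogonal (C := C') (fun x hx y hy => ?_) (by rwa [add_comm]) ?_
      · rw [← hCC y hy x hx]
        exact Finset.sum_congr rfl fun e _ => mul_comm _ _
      rintro _ ⟨g, rfl⟩
      rw [← hz g, hsum]
      exact Finset.sum_congr rfl fun e _ => by rw [coboundary_apply, mul_comm]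
    obtain ⟨f, hf⟩ := hzC
    obtain ⟨f', hf'⟩ := ext f
    refine ⟨f', fun e he => ?_⟩
    have := (congrFun hf ⟨e, (hmem e).1 he⟩).symm
    rwa [coboundary_apply, ← hf', ← hf'] at this

/-- A plane graph and its dual have orientations that make them a dual pair. -/
theorem PlaneEmbedding.exists_dualPair [Nonempty α] (P : PlaneEmbedding G φ) (hV : V(G).Finite)
    {E : Finset β} (hE : (E : Set β) = E(G)) :
    ∃ (t h : β → α) (t' h' : β → φ), Orients G t h ∧ Orients P.dual t' h' ∧
      DualPair E t h t' h' := by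
  obtain ⟨f₀, -⟩ := P.dual_connected.1
  let ext {γ : Type _} (c : γ) (F : E(G) → γ) : β → γ := fun e =>
    if he : e ∈ E(G) then F ⟨e, he⟩ else c
  have hext : ∀ {γ : Type _} (c : γ) (F : E(G) → γ) (e : E(G)), ext c F e = F e := by
    intro γ c F e
    simp [ext]
  obtain ⟨a⟩ := ‹Nonempty α›
  refine ⟨ext a fun e => P.tail (e, false), ext a fun e => P.tail (e, true),
    fun e => if he : e ∈ E(G) then P.face (⟨e, he⟩, false) else f₀,
    fun e => if he : e ∈ E(G) then P.face (⟨e, he⟩, true) else f₀,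
    fun e he => ?_, fun e he => ?_, ?_⟩
  · simpa [ext, he] using P.isLink_tail ⟨e, he⟩
  · have he' : e ∈ E(G) := he
    exact ⟨(⟨e, he'⟩, false), rfl, by simp [he'], by simp [he', Dart.rev]⟩
  · exact P.dualPair hV hE (by simp [ext]) (by simp [ext]) (by simp) (by simp)

end PlanarDuality

/-! ### Determinants with independent parameters in the rows. -/

section RowExpansion

open Matrix

variable {n : Type*} [Fintype n] [DecidableEq n]

theorem det_updateRow_add_smul (M : Matrix n n ℝ) (i : n) (p q : n → ℝ) (x : ℝ) :
    (M.updateRow i (p + x • q)).det = (M.updateRow i p).det + x * (M.updateRow i q).det := by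
  rw [det_updateRow_add, det_updateRow_smul]

theorem exists_int_add_mul_ne_zero {a b : ℝ} (hb : b ≠ 0) : ∃ x : ℤ, a + x * b ≠ 0 := by
  by_cases ha : a = 0
  · exact ⟨1, by simpa [ha]⟩
  · exact ⟨0, by simpa⟩

/-- A determinant whose rows are independent affine functions of integer parameters is nonzero for
some choice of the parameters if and only if it is nonzero for some choice, in every row, of the
constant or the leading coefficient. -/
theorem exists_int_det_ne_zero_iff (p q : n → n → ℝ) :
    (∃ x : n → ℤ, (of fun i => p i + (x i : ℝ) • q i).det ≠ 0) ↔
      ∃ U : Set n, ∃ M : Matrix n n ℝ, M.det ≠ 0 ∧ (∀ i ∈ U, M i = q i) ∧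
        ∀ i ∉ U, M i = p i := by
  constructor
  · rintro ⟨x, hx⟩
    -- The rows in `T` have already been replaced. Since the determinant is affine in the parameter
    -- of one row, a further row can always be replaced without making it zero.
    suffices H : ∀ T : Finset n, ∃ M : Matrix n n ℝ, M.det ≠ 0 ∧
        ∀ i, (i ∈ T → M i = p i ∨ M i = q i) ∧ (i ∉ T → M i = p i + (x i : ℝ) • q i) by
      obtain ⟨M, hM, H⟩ := H Finset.univ
      exact ⟨{i | M i = q i}, M, hM, fun i hi => hi, fun i hi =>
        ((H i).1 (Finset.mem_univ i)).resolve_right hi⟩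
    intro T
    induction T using Finset.induction_on with
    | empty => exact ⟨_, hx, fun i => ⟨by simp, fun _ => rfl⟩⟩
    | insert a T ha ih =>
      obtain ⟨M, hM, H⟩ := ih
      have hMa : M = M.updateRow a (p a + (x a : ℝ) • q a) := by
        rw [← (H a).2 ha]
        exact (Matrix.updateRow_eq_self M a).symm
      rw [hMa, det_updateRow_add_smul] at hM
      have : ∃ s, (s = p a ∨ s = q a) ∧ (M.updateRow a s).det ≠ 0 := by
        by_cases h : (M.updateRow a (p a)).det = 0
        · exact ⟨_, Or.inr rfl, fun h' => hM (by rw [h, h']; simp)⟩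
        · exact ⟨_, Or.inl rfl, h⟩
      obtain ⟨s, hs, hd⟩ := this
      refine ⟨_, hd, fun i => ?_⟩
      by_cases hi : i = a
      · subst hi
        simp [hs]
      · simpa [hi, Matrix.updateRow_ne] using H i
  · rintro ⟨U, M₀, hM₀, hU, hU'⟩
    suffices H : ∀ T : Finset n, ∃ M : Matrix n n ℝ, M.det ≠ 0 ∧
        ∀ i, (i ∈ T → ∃ x : ℤ, M i = p i + (x : ℝ) • q i) ∧ (i ∉ T → M i = M₀ i) by
      obtain ⟨M, hM, H⟩ := H Finset.univ
      choose x hx using fun i => (H i).1 (Finset.mem_univ i)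
      refine ⟨x, ?_⟩
      rwa [show (of fun i => p i + (x i : ℝ) • q i) = M from funext fun i => (hx i).symm]
    intro T
    induction T using Finset.induction_on with
    | empty => exact ⟨_, hM₀, fun i => ⟨by simp, fun _ => rfl⟩⟩
    | insert a T ha ih =>
      obtain ⟨M, hM, H⟩ := ih
      have hMa : M = M.updateRow a (M₀ a) := by
        rw [← (H a).2 ha]
        exact (Matrix.updateRow_eq_self M a).symm
      have : ∃ x : ℤ, (M.updateRow a (p a + (x : ℝ) • q a)).det ≠ 0 := by
        simp only [det_updateRow_add_smul]
        rw [hMa] at hM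
        by_cases haU : a ∈ U
        · exact exists_int_add_mul_ne_zero (hU a haU ▸ hM)
        · exact ⟨0, by simpa using hU' a haU ▸ hM⟩
      obtain ⟨x, hx⟩ := this
      refine ⟨_, hx, fun i => ?_⟩
      by_cases hi : i = a
      · subst hi
        simp only [Finset.mem_insert_self, not_true_eq_false, false_imp_iff, and_true, true_imp_iff]
        exact ⟨x, by simp⟩
      · simpa [hi, Matrix.updateRow_ne] using H i

theorem det_submatrix_ne_zero_iff {R C : Type*} [Fintype C] (N : R → C → ℝ) (ρ : n ≃ R)
    (κ : n ≃ C) :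
    (of fun i j => N (ρ i) (κ j)).det ≠ 0 ↔
      ∀ y : C → ℝ, (∀ a, ∑ b, N a b * y b = 0) → y = 0 := by
  rw [ne_eq, ← exists_mulVec_eq_zero_iff, not_exists]
  constructor
  · intro H y hy
    by_contra h0
    refine H (fun j => y (κ j)) ⟨fun h => h0 ?_, ?_⟩
    · ext b
      simpa using congrFun h (κ.symm b)
    · ext i
      rw [mulVec, dotProduct, Pi.zero_apply, ← hy (ρ i), ← Equiv.sum_comp κ]
      rfl
  · rintro H v ⟨hv, h⟩
    refine hv ?_
    have := H (fun b => v (κ.symm b)) fun a => by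
      have := congrFun h (ρ.symm a)
      rw [mulVec, dotProduct, Pi.zero_apply] at this
      rw [← this, ← Equiv.sum_comp κ]
      simp
    ext j
    simpa using congrFun this (κ j)

end RowExpansion

/-! ### Nonvanishing of Dodgson polynomials as a kernel condition. -/

section DodgsonVanishing

open Classical Matrix

variable {α β φ : Type*} {G : Graph α β}

/-- The part of a row of the Kirchhoff matrix that does not depend on the edge variables. -/
noncomputable def constRow (o : Orientation G) (r : V(G)) (I J : Set β) :
    Remaining G r I → Remaining G r J → ℝ
  | .inl e, .inr v => (if o.head e.1 = v.1.1 then 1 else 0) - (if o.tail e.1 = v.1.1 then 1 else 0)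
  | .inr v, .inl e =>
    -((if o.head e.1 = v.1.1 then 1 else 0) - (if o.tail e.1 = v.1.1 then 1 else 0))
  | _, _ => 0

/-- The coefficient of the edge variable in a row of the Kirchhoff matrix. -/
noncomputable def varRow (G : Graph α β) (r : V(G)) (I J K : Set β) :
    Remaining G r I → Remaining G r J → ℝ
  | .inl e, .inl e' => if e.1 = e'.1 ∧ e.1.1 ∉ K then 1 else 0
  | _, _ => 0

theorem kirchhoff_entry (o : Orientation G) (r : V(G)) (I J K : Set β) (x : β → ℤ)
    (a : Remaining G r I) (b : Remaining G r J) :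
    ((MvPolynomial.eval x (setZero K (kirchhoffMatrix o r
      (Sum.map (fun e : {e : E(G) // e.1 ∉ I} => e.1) id a)
      (Sum.map (fun e : {e : E(G) // e.1 ∉ J} => e.1) id b))) : ℤ) : ℝ) =
      constRow o r I J a b + ((a.elim (fun e => x e.1.1) fun _ => 0 : ℤ) : ℝ) *
        varRow G r I J K a b := by
  rcases a with e | v <;> rcases b with e' | v'
  · by_cases h : e.1 = e'.1
    · by_cases hK : e'.1.1 ∈ K <;>
        simp [kirchhoffMatrix, constRow, varRow, h, setZero, hK]
    · simp [kirchhoffMatrix, constRow, varRow, h]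
  · simp only [kirchhoffMatrix, constRow, varRow, incidence, Sum.map_inl, Sum.map_inr,
      fromBlocks_apply₁₂, of_apply, id]
    split_ifs <;> simp
  · simp only [kirchhoffMatrix, constRow, varRow, incidence, Sum.map_inl, Sum.map_inr,
      fromBlocks_apply₂₁, id]
    split_ifs <;> simp [*]
  · simp [kirchhoffMatrix, constRow, varRow]

/-- An integer polynomial is zero if it vanishes at all integer points. Distinct edge rows carry
distinct variables and the vertex rows carry none, so the parameters of the rows can be chosen
freely. -/
theorem dodgson_ne_zero_iff_exists_det (o : Orientation G) (r : V(G)) (I J K : Set β) {n : ℕ}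
    (ρ : Fin n ≃ Remaining G r I) (κ : Fin n ≃ Remaining G r J) :
    dodgson o r I J K ρ κ ≠ 0 ↔ ∃ x : Fin n → ℤ, (of fun i =>
      (fun j => constRow o r I J (ρ i) (κ j)) +
        (x i : ℝ) • fun j => varRow G r I J K (ρ i) (κ j)).det ≠ 0 := by
  have hev : ∀ x : β → ℤ, ((MvPolynomial.eval x (dodgson o r I J K ρ κ) : ℤ) : ℝ) =
      (of fun i => (fun j => constRow o r I J (ρ i) (κ j)) +
        (((ρ i).elim (fun e => x e.1.1) fun _ => 0 : ℤ) : ℝ) •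
          fun j => varRow G r I J K (ρ i) (κ j)).det := by
    intro x
    have := ((Int.castRingHom ℝ).comp (MvPolynomial.eval x)).map_det
      (((kirchhoffMatrix o r).map (setZero K)).submatrix
        (fun i => Sum.map (fun e : {e : E(G) // e.1 ∉ I} => e.1) id (ρ i))
        (fun j => Sum.map (fun e : {e : E(G) // e.1 ∉ J} => e.1) id (κ j)))
    refine this.trans (congrArg det ?_)
    ext i j
    exact kirchhoff_entry o r I J K x (ρ i) (κ j)
  constructor
  · intro H
    by_contra! hno
    refine H (MvPolynomial.funext fun x => ?_)
    have := (hev x).trans (hno _)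
    rw [map_zero]
    exact_mod_cast this
  · rintro ⟨x, hx⟩ h0
    refine hx ?_
    have := hev fun e => if he : ∃ (h : e ∈ E(G)), e ∉ I then
      x (ρ.symm (Sum.inl ⟨⟨e, he.1⟩, he.2⟩)) else 0
    rw [h0, map_zero, Int.cast_zero] at this
    rw [this]
    congr 1
    ext i j
    rcases hi : ρ i with e | v
    · have h1 : x i = x (ρ.symm (Sum.inl e)) := by rw [← hi, Equiv.symm_apply_apply]
      simp [hi, h1, e.2]
    · simp [hi, varRow]

/-- `U` is the set of rows that contribute their variable. The first clause, automatic for a nonzero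
determinant, keeps vertex rows and the edges of `J ∪ K` out of `U`. -/
theorem dodgson_ne_zero_iff (o : Orientation G) (r : V(G)) (I J K : Set β) {n : ℕ}
    (ρ : Fin n ≃ Remaining G r I) (κ : Fin n ≃ Remaining G r J) [Fintype (Remaining G r J)] :
    dodgson o r I J K ρ κ ≠ 0 ↔ ∃ U : Set (Remaining G r I),
      (∀ a ∈ U, ∃ b, varRow G r I J K a b ≠ 0) ∧ ∀ y : Remaining G r J → ℝ,
        (∀ a ∈ U, ∑ b, varRow G r I J K a b * y b = 0) →
        (∀ a ∉ U, ∑ b, constRow o r I J a b * y b = 0) → y = 0 := by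
  rw [dodgson_ne_zero_iff_exists_det, exists_int_det_ne_zero_iff]
  have key : ∀ U : Set (Remaining G r I),
      (of fun i j => (if ρ i ∈ U then varRow G r I J K (ρ i) (κ j) else
        constRow o r I J (ρ i) (κ j))).det ≠ 0 ↔ ∀ y : Remaining G r J → ℝ,
        (∀ a ∈ U, ∑ b, varRow G r I J K a b * y b = 0) →
        (∀ a ∉ U, ∑ b, constRow o r I J a b * y b = 0) → y = 0 := by
    intro U
    rw [det_submatrix_ne_zero_iff (fun a b => if a ∈ U then varRow G r I J K a b else
        constRow o r I J a b)]
    refine forall_congr' fun y => ⟨fun H h1 h2 => H fun a => ?_, fun H h => H ?_ ?_⟩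
    · by_cases ha : a ∈ U
      · simpa [ha] using h1 a ha
      · simpa [ha] using h2 a ha
    · intro a ha
      simpa [ha] using h a
    · intro a ha
      simpa [ha] using h a
  constructor
  · rintro ⟨U, M, hM, h1, h2⟩
    have hMeq : M = of fun i j => (if ρ i ∈ ρ '' U then varRow G r I J K (ρ i) (κ j) else
        constRow o r I J (ρ i) (κ j)) := by
      ext i j
      by_cases hi : i ∈ U
      · simp [hi, h1 i hi]
      · simp [hi, h2 i hi]
    refine ⟨ρ '' U, ?_, (key _).1 (hMeq ▸ hM)⟩
    rintro _ ⟨i, hi, rfl⟩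
    by_contra! h0
    refine hM (det_eq_zero_of_row_eq_zero i fun j => ?_)
    rw [h1 i hi]
    exact h0 _
  · rintro ⟨U, -, hU⟩
    refine ⟨ρ ⁻¹' U, _, (key U).2 hU, fun i hi => ?_, fun i hi => ?_⟩
    · ext j
      exact if_pos hi
    · ext j
      exact if_neg hi

/-- The edges in `Y` span the oriented graph: a potential that is constant along `Y` is constant
along all edges. -/
def Spanning (E : Finset β) (t h : β → α) (Y : Set β) : Prop :=
  ∀ f : α → ℝ, (∀ e ∈ E, e ∈ Y → f (h e) = f (t e)) → ∀ e ∈ E, f (h e) = f (t e)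

/-- The edges in `Y` form a forest: there is no nonzero flow on `Y`. -/
def Independent (E : Finset β) (t h : β → α) (Y : Set β) : Prop :=
  ∀ z, IsFlow E t h z → (∀ e ∈ E, e ∉ Y → z e = 0) → ∀ e ∈ E, z e = 0

/-- The edge sets that contribute to a Dodgson polynomial. -/
def Contributes (E : Finset β) (t h : β → α) (I J S : Set β) : Prop :=
  ∃ X : Set β, S ⊆ X ∧ Spanning E t h (X \ I) ∧ Independent E t h (X \ J)

theorem sum_indicator_mul (r : V(G)) [Fintype (VertexNe G r)] {x : α} (hx : x ∈ V(G))
    {F : α → ℝ} (hF : F r = 0) :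
    ∑ v : VertexNe G r, (if x = v.1.1 then 1 else 0) * F v.1.1 = F x := by
  by_cases hxr : x = r
  · rw [hxr, hF]
    refine Finset.sum_eq_zero fun v _ => ?_
    rw [if_neg fun h => v.2 (Subtype.ext h.symm), zero_mul]
  · rw [Finset.sum_eq_single ⟨⟨x, hx⟩, fun h => hxr (congrArg Subtype.val h)⟩]
    · simp
    · intro v _ hv
      rw [if_neg fun h => hv (Subtype.ext (Subtype.ext h.symm)), zero_mul]
    · simp

theorem Orientation.sum_incidence_mul (o : Orientation G) (r : V(G)) [Fintype (VertexNe G r)]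
    (e : E(G)) {F : α → ℝ} (hF : F r = 0) :
    ∑ v : VertexNe G r, ((if o.head e = v.1.1 then (1 : ℝ) else 0) -
      (if o.tail e = v.1.1 then 1 else 0)) * F v.1.1 = F (o.head e) - F (o.tail e) := by
  simp only [sub_mul, Finset.sum_sub_distrib]
  rw [sum_indicator_mul r (o.isLink e).right_mem hF, sum_indicator_mul r (o.isLink e).left_mem hF]

theorem Connected.eq_of_edges (hG : Connected G) {E : Finset β} (hE : (E : Set β) = E(G))
    {t h : β → α} (o : Orients G t h) {f : α → ℝ} (hf : ∀ e ∈ E, f (h e) = f (t e)) {x y : α}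
    (hx : x ∈ V(G)) (hy : y ∈ V(G)) : f x = f y := by
  have H := hG.2 x hx y hy
  induction H with
  | refl => rfl
  | tail _ hadj ih =>
    obtain ⟨e, he⟩ := hadj
    refine (ih he.left_mem).trans ?_
    have h1 := hf e (by rw [← Finset.mem_coe, hE]; exact he.edge_mem)
    rcases (o.isLink_iff he.edge_mem _ _).1 he with ⟨rfl, rfl⟩ | ⟨rfl, rfl⟩
    exacts [h1.symm, h1]

end DodgsonVanishing

/-! ### Spanning sets, forests and the duality of Dodgson indices. -/

section DodgsonDuality

open Classical

variable {α β φ : Type*} {G : Graph α β}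

theorem sum_remaining_edges [Fintype E(G)] {J : Set β} {F : E(G) → ℝ}
    (hF : ∀ e, e.1 ∈ J → F e = 0) : ∑ e : {e : E(G) // e.1 ∉ J}, F e.1 = ∑ e, F e := by
  rw [← Finset.sum_subtype (Finset.univ.filter fun e : E(G) => e.1 ∉ J) (by simp) F]
  refine Finset.sum_subset (Finset.filter_subset _ _) fun e _ he => hF e ?_
  simpa using he

theorem Orientation.orients (o : Orientation G) {t h : β → α} (ht : ∀ e : E(G), t e = o.tail e)
    (hh : ∀ e : E(G), h e = o.head e) : Orients G t h := fun e he => by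
  have := o.isLink ⟨e, he⟩
  rwa [← ht, ← hh] at this

/-- A kernel vector is a pair of an edge function `z` and a vertex function `f`, and the equations
decouple. Rows in `U` make `z` vanish outside `X`, vertex rows make `z` a flow, and the other edge
rows make `f` constant along `X \ I`. So a trivial kernel yields both the forest and the spanning
condition. -/
theorem contributes_of_rows [Fintype E(G)] [Fintype V(G)] {E : Finset β}
    (hE : (E : Set β) = E(G)) {t h : β → α}
    (o : Orientation G) (ht : ∀ e : E(G), t e = o.tail e) (hh : ∀ e : E(G), h e = o.head e)
    (r : V(G)) {I J K S : Set β} (hS : I ∪ J ∪ K = S)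
    (H : ∃ U : Set (Remaining G r I),
      (∀ a ∈ U, ∃ b, varRow G r I J K a b ≠ 0) ∧ ∀ y : Remaining G r J → ℝ,
        (∀ a ∈ U, ∑ b, varRow G r I J K a b * y b = 0) →
        (∀ a ∉ U, ∑ b, constRow o r I J a b * y b = 0) → y = 0) :
    Contributes E t h I J S := by
  have hmem : ∀ e, e ∈ E ↔ e ∈ E(G) := fun e => by rw [← hE, Finset.mem_coe]
  have ho := o.orients ht hh
  obtain ⟨U, hUq, hU⟩ := H
  have hUr : ∀ v, (Sum.inr v : Remaining G r I) ∉ U := fun v hv => by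
    obtain ⟨b, hb⟩ := hUq _ hv
    exact hb rfl
  -- `X` is the complement of `U`; it contains `I` vacuously, as those rows are deleted.
  refine ⟨{e | ∀ (he : e ∈ E(G)) (hI : e ∉ I), (Sum.inl ⟨⟨e, he⟩, hI⟩ : Remaining G r I) ∉ U},
    fun e heS he hI heU => ?_, fun f hf e he => ?_, fun z hz hzX e he => ?_⟩
  · obtain ⟨e' | v, hb⟩ := hUq _ heU
    · simp only [varRow, ne_eq, ite_eq_right_iff, one_ne_zero, imp_false, not_not] at hb
      have heJ : e ∉ J := fun h => e'.2 (hb.1 ▸ h)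
      rw [← hS] at heS
      exact heS.elim (fun h => h.elim hI heJ) hb.2
    · exact hb rfl
  · have hy := hU (Sum.elim (fun _ => 0) fun v => f v.1.1 - f r) ?_ ?_
    · have hfr : ∀ v ∈ V(G), f v = f r := fun v hv => by
        by_cases hvr : v = r
        · rw [hvr]
        · have := congrFun hy (Sum.inr ⟨⟨v, hv⟩, fun h => hvr (congrArg Subtype.val h)⟩)
          exact sub_eq_zero.1 this
      have hl := ho e ((hmem e).1 he)
      rw [hfr _ hl.left_mem, hfr _ hl.right_mem]
    · rintro (a | v) ha
      · simp [Fintype.sum_sum_type, varRow]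
      · exact absurd ha (hUr v)
    · rintro (a | v) ha
      · simp only [Fintype.sum_sum_type, constRow, Sum.elim_inl, Sum.elim_inr, mul_zero,
          Finset.sum_const_zero, zero_add]
        rw [o.sum_incidence_mul r a.1 (F := fun v => f v - f r) (sub_self _), ← hh, ← ht,
          hf a.1 ((hmem _).2 a.1.2) ⟨fun _ _ => ha, a.2⟩, sub_self]
      · simp [Fintype.sum_sum_type, constRow]
  · have hzJ : ∀ e ∈ E(G), e ∈ J → z e = 0 := fun e he heJ =>
      hzX e ((hmem e).2 he) fun h => h.2 heJ
    have hy := hU (Sum.elim (fun e => z e.1.1) fun _ => 0) ?_ ?_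
    · by_cases heJ : e ∈ J
      · exact hzJ e ((hmem e).1 he) heJ
      · exact congrFun hy (Sum.inl ⟨⟨e, (hmem e).1 he⟩, heJ⟩)
    · rintro (a | v) ha
      · simp only [Fintype.sum_sum_type, Sum.elim_inl, Sum.elim_inr, mul_zero,
          Finset.sum_const_zero, add_zero]
        refine Finset.sum_eq_zero fun e' _ => ?_
        by_cases hae : a.1 = e'.1
        · rw [← hae, hzX a.1 ((hmem _).2 a.1.2) fun h => h.1 a.1.2 a.2 ha, mul_zero]
        · simp [varRow, hae]
      · exact absurd ha (hUr v)
    · rintro (a | v) ha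
      · simp [Fintype.sum_sum_type, constRow]
      · simp only [Fintype.sum_sum_type, constRow, Sum.elim_inl, Sum.elim_inr, mul_zero,
          Finset.sum_const_zero, add_zero]
        rw [sum_remaining_edges (F := fun e => -((if o.head e = v.1.1 then 1 else 0) -
          (if o.tail e = v.1.1 then 1 else 0)) * z e) fun e heJ => by
            rw [hzJ e e.2 heJ, mul_zero], ← neg_eq_zero, ← Finset.sum_neg_distrib]
        have hzv := hz fun x => if x = v.1.1 then 1 else 0
        rw [Finset.sum_subtype E hmem] at hzv
        exact Eq.trans (Finset.sum_congr rfl fun e _ => by rw [hh, ht]; ring) hzv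

theorem rows_of_contributes [Fintype E(G)] [Fintype V(G)] (hG : Connected G) {E : Finset β}
    (hE : (E : Set β) = E(G)) {t h : β → α}
    (o : Orientation G) (ht : ∀ e : E(G), t e = o.tail e) (hh : ∀ e : E(G), h e = o.head e)
    (r : V(G)) {I J K S : Set β} (hS : I ∪ J ∪ K = S)
    (H : Contributes E t h I J S) :
    ∃ U : Set (Remaining G r I),
      (∀ a ∈ U, ∃ b, varRow G r I J K a b ≠ 0) ∧ ∀ y : Remaining G r J → ℝ,
        (∀ a ∈ U, ∑ b, varRow G r I J K a b * y b = 0) →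
        (∀ a ∉ U, ∑ b, constRow o r I J a b * y b = 0) → y = 0 := by
  have hmem : ∀ e, e ∈ E ↔ e ∈ E(G) := fun e => by rw [← hE, Finset.mem_coe]
  have ho := o.orients ht hh
  obtain ⟨X, hSX, hsp, hind⟩ := H
  have hJX : ∀ e, e ∉ X → e ∉ I ∧ e ∉ J ∧ e ∉ K := fun e he =>
    ⟨fun h => he (hSX (hS ▸ Or.inl (Or.inl h))), fun h => he (hSX (hS ▸ Or.inl (Or.inr h))),
      fun h => he (hSX (hS ▸ Or.inr h))⟩
  refine ⟨{a | ∃ e : {e : E(G) // e.1 ∉ I}, a = Sum.inl e ∧ e.1.1 ∉ X}, ?_, fun y h1 h2 => ?_⟩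
  · rintro _ ⟨e, rfl, heX⟩
    exact ⟨Sum.inl ⟨e.1, (hJX _ heX).2.1⟩, by simp [varRow, (hJX _ heX).2.2]⟩
  · have hyX : ∀ e : {e : E(G) // e.1 ∉ J}, e.1.1 ∉ X → y (Sum.inl e) = 0 := by
      intro e heX
      have := h1 (Sum.inl ⟨e.1, (hJX _ heX).1⟩) ⟨_, rfl, heX⟩
      rw [Fintype.sum_sum_type] at this
      rw [Finset.sum_eq_zero (s := Finset.univ (α := VertexNe G r)) fun v _ => by
        simp [varRow], add_zero, Finset.sum_eq_single e] at this
      · simpa [varRow, (hJX _ heX).2.2] using this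
      · intro e' _ hne
        rw [varRow, if_neg fun h => hne (Subtype.ext h.1.symm), zero_mul]
      · simp
    -- The value 0 at `r` stands for the deleted column; connectedness later spreads it to all
    -- vertices.
    let f : α → ℝ := fun v => if hv : ∃ hv : v ∈ V(G), (⟨v, hv⟩ : V(G)) ≠ r then
      y (Sum.inr ⟨⟨v, hv.1⟩, hv.2⟩) else 0
    have hfr : f r = 0 := by simp [f]
    have hfv : ∀ v : VertexNe G r, f v.1.1 = y (Sum.inr v) := fun v => by
      have : ∃ hv : v.1.1 ∈ V(G), (⟨v.1.1, hv⟩ : V(G)) ≠ r := ⟨v.1.2, v.2⟩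
      simp only [f, dif_pos this]
    have hf := hsp f fun e he heX => by
      have heE := (hmem e).1 he
      have := h2 (Sum.inl ⟨⟨e, heE⟩, heX.2⟩) (by
        rintro ⟨e', he', heX'⟩
        rw [← Sum.inl_injective he'] at heX'
        exact heX' heX.1)
      simp only [Fintype.sum_sum_type, constRow, zero_mul, Finset.sum_const_zero, zero_add,
        ← hfv] at this
      rw [o.sum_incidence_mul r ⟨e, heE⟩ hfr, ← hh, ← ht] at this
      linarith
    let z : β → ℝ := fun e => if he : ∃ he : e ∈ E(G), e ∉ J then
      y (Sum.inl ⟨⟨e, he.1⟩, he.2⟩) else 0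
    have hzv : ∀ e : {e : E(G) // e.1 ∉ J}, z e.1.1 = y (Sum.inl e) := fun e => by
      have : ∃ _ : e.1.1 ∈ E(G), e.1.1 ∉ J := ⟨e.1.2, e.2⟩
      simp only [z, dif_pos this]
    have hzJ : ∀ e ∈ J, z e = 0 := fun e he => by simp [z, he]
    have hz : IsFlow E t h z := by
      intro g
      have hcol : ∀ v : VertexNe G r, ∑ e : E(G), z e * ((if o.head e = v.1.1 then 1 else 0) -
          (if o.tail e = v.1.1 then 1 else 0)) = 0 := by
        intro v
        have := h2 (Sum.inr v) (by simp)
        simp only [Fintype.sum_sum_type, constRow, zero_mul, Finset.sum_const_zero, add_zero,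
          ← hzv] at this
        rw [sum_remaining_edges (F := fun e => -((if o.head e = v.1.1 then 1 else 0) -
          (if o.tail e = v.1.1 then 1 else 0)) * z e) fun e heJ => by
            rw [hzJ e heJ, mul_zero]] at this
        rw [← neg_eq_zero, ← Finset.sum_neg_distrib]
        exact Eq.trans (Finset.sum_congr rfl fun e _ => by ring) this
      calc ∑ e ∈ E, z e * (g (h e) - g (t e))
          = ∑ e : E(G), z e * ((g (o.head e) - g r) - (g (o.tail e) - g r)) := by
            rw [Finset.sum_subtype E hmem]
            exact Finset.sum_congr rfl fun e _ => by rw [hh, ht]; ring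
        _ = ∑ e : E(G), ∑ v : VertexNe G r, (z e * ((if o.head e = v.1.1 then 1 else 0) -
              (if o.tail e = v.1.1 then 1 else 0))) * (g v.1.1 - g r) := by
            refine Finset.sum_congr rfl fun e _ => ?_
            rw [← o.sum_incidence_mul r e (F := fun v => g v - g r) (sub_self _),
              Finset.mul_sum]
            exact Finset.sum_congr rfl fun v _ => by ring
        _ = 0 := by
            rw [Finset.sum_comm]
            exact Finset.sum_eq_zero fun v _ => by
              rw [← Finset.sum_mul, hcol v, zero_mul]
    have hz0 := hind z hz fun e he heX => by
      by_cases heJ : e ∈ J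
      · exact hzJ e heJ
      · have := hyX ⟨⟨e, (hmem e).1 he⟩, heJ⟩ fun h => heX ⟨h, heJ⟩
        rwa [← hzv] at this
    ext (e | v)
    · rw [← hzv, hz0 _ ((hmem _).2 e.1.2), Pi.zero_apply]
    · rw [← hfv, hG.eq_of_edges hE ho hf v.1.2 r.2, hfr, Pi.zero_apply]

theorem dodgson_ne_zero_iff_contributes (hG : Connected G) (hV : V(G).Finite) {E : Finset β}
    (hE : (E : Set β) = E(G)) {t h : β → α}
    (o : Orientation G) (ht : ∀ e : E(G), t e = o.tail e) (hh : ∀ e : E(G), h e = o.head e)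
    (r : V(G)) {I J K S : Set β} (hS : I ∪ J ∪ K = S) {n : ℕ}
    (ρ : Fin n ≃ Remaining G r I) (κ : Fin n ≃ Remaining G r J) :
    dodgson o r I J K ρ κ ≠ 0 ↔ Contributes E t h I J S := by
  let _ : Fintype E(G) := (hE ▸ E.finite_toSet : E(G).Finite).fintype
  let _ : Fintype V(G) := hV.fintype
  rw [dodgson_ne_zero_iff]
  exact ⟨contributes_of_rows hE o ht hh r hS, rows_of_contributes hG hE o ht hh r hS⟩

theorem Orients.exists_sign {G : Graph α β} {t h t' h' : β → α} (o : Orients G t h)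
    (o' : Orients G t' h') : ∃ s : β → ℝ, ∀ e ∈ E(G), s e ≠ 0 ∧
      ∀ f : α → ℝ, f (h' e) - f (t' e) = s e * (f (h e) - f (t e)) := by
  refine ⟨fun e => if t' e = t e ∧ h' e = h e then 1 else -1, fun e he => ?_⟩
  beta_reduce
  split_ifs with H
  · exact ⟨one_ne_zero, fun f => by rw [H.1, H.2, one_mul]⟩
  · rcases (o'.isLink_iff he _ _).1 (o e he) with ⟨h1, h2⟩ | ⟨h1, h2⟩
    · exact absurd ⟨h1.symm, h2.symm⟩ H
    · exact ⟨by norm_num, fun f => by rw [h1, h2]; ring⟩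

/-- Reorienting edges only changes signs of coordinates, so the criterion does not depend on the
orientation used in the determinant. -/
theorem Orients.contributes {t h t' h' : β → α} (o : Orients G t h)
    (o' : Orients G t' h') {E : Finset β} (hE : (E : Set β) = E(G)) {I J S : Set β}
    (H : Contributes E t h I J S) : Contributes E t' h' I J S := by
  have hmem : ∀ e ∈ E, e ∈ E(G) := fun e he => hE ▸ he
  obtain ⟨s, hs⟩ := o.exists_sign o'
  obtain ⟨X, hSX, hsp, hind⟩ := H
  have hd : ∀ (f : α → ℝ), ∀ e ∈ E, f (h' e) = f (t' e) ↔ f (h e) = f (t e) := fun f e he => by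
    rw [← sub_eq_zero, (hs e (hmem e he)).2 f, mul_eq_zero, sub_eq_zero]
    exact or_iff_right (hs e (hmem e he)).1
  refine ⟨X, hSX, fun f hf e he => (hd f e he).2 (hsp f (fun a ha haX =>
    (hd f a ha).1 (hf a ha haX)) e he), fun z hz hzX e he => ?_⟩
  have := hind (fun e => z e * s e) (fun f => ?_) (fun a ha haX => by rw [hzX a ha haX, zero_mul])
    e he
  · exact (mul_eq_zero.1 this).resolve_right (hs e (hmem e he)).1
  · rw [← hz f]
    exact Finset.sum_congr rfl fun e he => by rw [(hs e (hmem e he)).2 f, mul_assoc]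

theorem DualPair.independent_of_spanning {E : Finset β} {t h : β → α} {t' h' : β → φ}
    (D : DualPair E t h t' h') {Y Y' : Set β} (hY : ∀ e ∈ E, e ∈ Y' ↔ e ∉ Y)
    (H : Spanning E t h Y) : Independent E t' h' Y' := fun z hz hzY e he => by
  obtain ⟨f, hf⟩ := D.exists_left z hz
  rw [hf e he, H f (fun a ha haY => ?_) e he, sub_self]
  rw [← sub_eq_zero, ← hf a ha, hzY a ha fun h => (hY a ha).1 h haY]

theorem DualPair.spanning_of_independent {E : Finset β} {t h : β → α} {t' h' : β → φ}
    (D : DualPair E t h t' h') {Y Y' : Set β} (hY : ∀ e ∈ E, e ∈ Y' ↔ e ∉ Y)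
    (H : Independent E t h Y) : Spanning E t' h' Y' := fun g hg e he => by
  rw [← sub_eq_zero]
  exact H _ (D.isFlow_left g) (fun a ha haY => sub_eq_zero.2 (hg a ha ((hY a ha).2 haY))) e he

theorem DualPair.contributes {E : Finset β} {t h : β → α} {t' h' : β → φ}
    (D : DualPair E t h t' h') {I J S : Set β} (hI : I ⊆ S) (hJ : J ⊆ S)
    (H : Contributes E t h I J S) : Contributes E t' h' (S \ J) (S \ I) S := by
  obtain ⟨X, hSX, hsp, hind⟩ := H
  -- As `I, J ⊆ S ⊆ X`, removing `S \ J` from `Xᶜ ∪ S` leaves the complement of `X \ J`, and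
  -- removing `S \ I` leaves that of `X \ I`.
  refine ⟨Xᶜ ∪ S, Set.subset_union_right, D.spanning_of_independent (fun e _ => ?_) hind,
    D.independent_of_spanning (fun e _ => ?_) hsp⟩
  · have h1 := @hSX e
    have h2 := @hJ e
    simp only [Set.mem_sdiff, Set.mem_union, Set.mem_compl_iff]
    tauto
  · have h1 := @hSX e
    have h2 := @hI e
    simp only [Set.mem_sdiff, Set.mem_union, Set.mem_compl_iff]
    tauto

theorem IsDodgsonIndex.compl {S I J K : Set β} (hS : S.ncard = 5) (H : IsDodgsonIndex S I J K) :
    IsDodgsonIndex S (S \ J) (S \ I) (I ∩ J) := by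
  obtain ⟨hU, hIK, hJK, H⟩ := H
  have hfin : S.Finite := Set.finite_of_ncard_ne_zero (by omega)
  have hIS : I ⊆ S := hU ▸ fun e he => Or.inl (Or.inl he)
  have hJS : J ⊆ S := hU ▸ fun e he => Or.inl (Or.inr he)
  have hI := Set.ncard_sdiff_add_ncard_of_subset hIS hfin
  have hJ := Set.ncard_sdiff_add_ncard_of_subset hJS hfin
  have hK : (S \ J) ∩ (S \ I) = K := by
    ext e
    have h1 : e ∉ I ∩ K := by simp [hIK]
    have h2 : e ∉ J ∩ K := by simp [hJK]
    subst hU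
    simp only [Set.mem_inter_iff, Set.mem_sdiff, Set.mem_union] at *
    tauto
  refine ⟨?_, ?_, ?_, ?_⟩
  · ext e
    have h1 := @hIS e
    simp only [Set.mem_inter_iff, Set.mem_sdiff, Set.mem_union]
    tauto
  · ext e
    simp only [Set.mem_inter_iff, Set.mem_sdiff, Set.mem_empty_iff_false]
    tauto
  · ext e
    simp only [Set.mem_inter_iff, Set.mem_sdiff, Set.mem_empty_iff_false]
    tauto
  · rw [hK]
    rcases H with ⟨h1, h2, h3, h4⟩ | ⟨h1, h2, h3, h4⟩
    · exact Or.inr ⟨by omega, by omega, h4, h3⟩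
    · exact Or.inl ⟨by omega, by omega, h4, h3⟩

theorem configSplits_iff_not_contributes (hG : Connected G) (hV : V(G).Finite) {E : Finset β}
    (hE : (E : Set β) = E(G)) {t h : β → α} (ho : Orients G t h) {S : Set β} (hS : S ⊆ E(G)) :
    ConfigSplits G S ↔ ∃ I J K, IsDodgsonIndex S I J K ∧ ¬ Contributes E t h I J S := by
  refine exists_congr fun I => exists_congr fun J => exists_congr fun K =>
    and_congr_right fun hidx => ?_
  obtain ⟨hU, -, -, hcard⟩ := hidx
  constructor
  · rintro ⟨o, r, n, ρ, κ, h0⟩ H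
    let t' : β → α := fun e => if he : e ∈ E(G) then o.tail ⟨e, he⟩ else r
    let h' : β → α := fun e => if he : e ∈ E(G) then o.head ⟨e, he⟩ else r
    have ht' : ∀ e : E(G), t' e = o.tail e := fun e => by simp [t']
    have hh' : ∀ e : E(G), h' e = o.head e := fun e => by simp [h']
    have ho' : Orients G t' h' := fun e he => by
      have := o.isLink ⟨e, he⟩
      rwa [← ht', ← hh'] at this
    exact (dodgson_ne_zero_iff_contributes hG hV hE o ht' hh' r hU ρ κ).2
      (ho.contributes ho' hE H) h0
  · intro H
    obtain ⟨x, hx⟩ := hG.1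
    let r : V(G) := ⟨x, hx⟩
    let o : Orientation G := ⟨fun e => t e, fun e => h e, fun e => ho e e.2⟩
    have hEf : E(G).Finite := hE ▸ E.finite_toSet
    have : Finite E(G) := hEf
    have : Finite V(G) := hV
    have hrem : ∀ T : Set β, T ⊆ E(G) →
        Nat.card (Remaining G r T) + T.ncard = Nat.card E(G) + Nat.card (VertexNe G r) := by
      intro T hT
      have h1 : Nat.card {e : E(G) // e.1 ∉ T} = (E(G) \ T).ncard := by
        rw [← Nat.card_coe_set_eq]
        exact Nat.card_congr (Equiv.subtypeSubtypeEquivSubtypeInter (· ∈ E(G)) (· ∉ T))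
      have h2 := Set.ncard_sdiff_add_ncard_of_subset hT hEf
      rw [Nat.card_sum, h1, Nat.card_coe_set_eq]
      omega
    have hI : I ⊆ E(G) := Set.Subset.trans (hU ▸ fun e he => Or.inl (Or.inl he)) hS
    have hJ : J ⊆ E(G) := Set.Subset.trans (hU ▸ fun e he => Or.inl (Or.inr he)) hS
    -- Since `|I| = |J|`, the remaining matrix is square, so the orderings `ρ` and `κ` exist.
    have hIJ : Nat.card (Remaining G r J) = Nat.card (Remaining G r I) := by
      have h1 := hrem I hI
      have h2 := hrem J hJ
      omega
    let ρ := (Finite.equivFin (Remaining G r I)).symm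
    let κ := (Finite.equivFinOfCardEq hIJ).symm
    refine ⟨o, r, _, ρ, κ, ?_⟩
    by_contra h0
    exact H ((dodgson_ne_zero_iff_contributes hG hV hE o (fun _ => rfl) (fun _ => rfl) r hU ρ κ).1
      h0)

theorem DualPair.splits {G' : Graph φ β} {E : Finset β} {t h : β → α}
    {t' h' : β → φ} (D : DualPair E t h t' h') (hG : Connected G) (hG' : Connected G')
    (hV : V(G).Finite) (hV' : V(G').Finite) (hE : (E : Set β) = E(G)) (hE' : (E : Set β) = E(G'))
    (o : Orients G t h) (o' : Orients G' t' h') (H : Splits G) : Splits G' := by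
  rintro S ⟨hS, hS5⟩
  have hSG : S ⊆ E(G) := by rwa [← hE, hE']
  obtain ⟨I, J, K, hidx, hc⟩ := (configSplits_iff_not_contributes hG hV hE o hSG).1
    (H S ⟨hSG, hS5⟩)
  refine (configSplits_iff_not_contributes hG' hV' hE' o' hS).2
    ⟨_, _, _, hidx.compl hS5, fun hc' => hc ?_⟩
  have hI : I ⊆ S := hidx.1 ▸ fun e he => Or.inl (Or.inl he)
  have hJ : J ⊆ S := hidx.1 ▸ fun e he => Or.inl (Or.inr he)
  -- Complementing in `S` twice returns the original `I` and `J`.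
  have := D.symm.contributes Set.sdiff_subset Set.sdiff_subset hc'
  rwa [Set.sdiff_sdiff_cancel_left hI, Set.sdiff_sdiff_cancel_left hJ] at this

end DodgsonDuality

end FeynmanSplit

theorem mainTheorem8 {α β φ : Type*} :
    (∀ (G : Graph α β), V(G).Finite → E(G).Finite → FeynmanSplit.Connected G →
      ∀ P : FeynmanSplit.PlaneEmbedding G φ,
        FeynmanSplit.Splits G ↔ FeynmanSplit.Splits P.dual) ∧
    (∀ (H : FeynmanSplit.EnhancedGraph α β), V(H.graph).Finite → E(H.graph).Finite →
      ∀ (P : FeynmanSplit.PlaneEmbedding H.graph φ) (S : Set β),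
        FeynmanSplit.IsFiveConfig H.graph S →
          (H.ConfigSplits S ↔ (H.dual P).ConfigSplits S)) := by
  refine ⟨fun G hV hE hG P => ?_, fun H hV hE P S hS => ?_⟩
  · have : Nonempty α := ⟨hG.1.some⟩
    have := P.finite_faces
    obtain ⟨t, h, t', h', o, o', D⟩ := P.exists_dualPair hV hE.coe_toFinset
    have hV' : V(P.dual).Finite := Set.toFinite _
    have hE' : (hE.toFinset : Set β) = E(P.dual) := hE.coe_toFinset
    exact ⟨D.splits hG P.dual_connected hV hV' hE.coe_toFinset hE' o o',
      D.symm.splits P.dual_connected hG hV' hV hE' hE.coe_toFinset o' o⟩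
  · obtain ⟨hSE, hS5⟩ := hS
    -- An edge of `S` provides a vertex, the default value of tails and heads off the edge set.
    obtain ⟨e, he⟩ : S.Nonempty := Set.nonempty_of_ncard_ne_zero (by omega)
    obtain ⟨x, -, -⟩ := H.graph.exists_isLink_of_mem_edgeSet (hSE he)
    have : Nonempty α := ⟨x⟩
    obtain ⟨t, h, t', h', o, o', D⟩ := P.exists_dualPair hV hE.coe_toFinset
    lift S to Finset β using hE.subset hSE
    rw [Set.ncard_coe_finset] at hS5
    exact D.configSplits_iff (H := H) (H' := H.dual P) o o' hE.coe_toFinset hE.coe_toFinset rfl rfl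
      hS5.le (by simpa [← Finset.coe_subset] using hSE)
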